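/- All graphs are finite and simple. A cover of a graph $G$ is a pair $(L,H)$, where $H$ is a graph and $L$ assigns to each vertex of $G$ a set of vertices of $H$, such that: the sets $L(u)$, $u\in V(G)$, are pairwise disjoint and partition $V(H)$; each $L(u)$ induces a complete subgraph of $H$; if $u\neq v$ are non-adjacent in $G$, there is no edge of $H$ between $L(u)$ and $L(v)$; and if $uv\in E(G)$, the edges of $H$ between $L(u)$ and $L(v)$ form a (possibly empty) matching. The cover is $m$-fold if $|L(u)|=m$ for all $u\in V(G)$. The DP-chromatic number $\chi_{DP}(G)$ is the least positive integer $m$ such that for every $m$-fold cover $(L,H)$ of $G$ the graph $H$ has an independent set of size $|V(G)|$. Let $G\vee K_s$ be the join of $G$ and the complete graph $K_s$ on $s$ vertices ($s\ge 0$), and let $\chi$ be the chromatic number. Define $$Z_{DP}(G)=\min\{s\in\{0,1,2,\dots\}:\ \chi_{DP}(G\vee K_s)=\chi(G\vee K_s)\},\qquad Z_{DP}(n)=\max_{|V(G)|=n} Z_{DP}(G).$$ Theorem. For every integer $n\ge 2$, the number $Z_{DP}(n)$ is well defined (finite) and $$Z_{DP}(n)\le n^2-\frac{n+3}{2}.$$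 -/

import Mathlib

namespace DPColoring

universe u v

/-- The join of two (vertex-disjoint) graphs: the disjoint union of the two graphs together with
all edges between the two vertex sets. -/
def join {V : Type u} {W : Type v} (G : SimpleGraph V) (K : SimpleGraph W) :
    SimpleGraph (V ⊕ W) :=
  (G ⊕g K) ⊔ completeBipartiteGraph V W

/-- A cover `(L, H)` of the graph `G`, the vertex set of `H` being the type `W`. -/
structure Cover {V : Type u} (G : SimpleGraph V) (W : Type u) where
  /-- the graph `H` -/
  H : SimpleGraph W
  /-- the map `L` from the vertices of `G` to the sets of vertices of `H` -/
  L : V → Set W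
  /-- the sets `L u` partition the vertex set of `H` (first half: they are disjoint) -/
  disjoint : Pairwise fun a b => Disjoint (L a) (L b)
  /-- the sets `L u` partition the vertex set of `H` (second half: they cover it) -/
  cover : ⋃ a, L a = Set.univ
  /-- each `L u` induces a complete subgraph of `H` -/
  clique : ∀ a, H.IsClique (L a)
  /-- there is no edge of `H` between `L u` and `L v` if `u ≠ v` are not adjacent in `G` -/
  no_edge : ∀ a b, a ≠ b → ¬ G.Adj a b → ∀ x ∈ L a, ∀ y ∈ L b, ¬ H.Adj x y
  /-- the edges of `H` between `L u` and `L v` form a (possibly empty) matching if `uv` is an edge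
  of `G`: a vertex of `L u` has at most one neighbour in `L v`, and (exchanging `u` and `v`) a
  vertex of `L v` has at most one neighbour in `L u` -/
  matching : ∀ a b, G.Adj a b → ∀ x ∈ L a, ∀ y ∈ L b, ∀ z ∈ L b,
    H.Adj x y → H.Adj x z → y = z

/-- A cover is `m`-fold if each `L u` has exactly `m` elements. -/
def Cover.IsFold {V : Type u} {G : SimpleGraph V} {W : Type u} (C : Cover G W) (m : ℕ) : Prop :=
  ∀ a, (C.L a).encard = m

/-- `G` is colorable with respect to the cover `(L, H)` if `H` has an independent set of
size `|V(G)|`. -/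
def Cover.Colorable {V : Type u} {G : SimpleGraph V} {W : Type u} (C : Cover G W) : Prop :=
  ∃ I : Set W, C.H.IsIndepSet I ∧ I.encard = ENat.card V

/-- Every `m`-fold cover of `G` admits a coloring. -/
def DPColorable {V : Type u} (G : SimpleGraph V) (m : ℕ) : Prop :=
  ∀ (W : Type u) (C : Cover G W), C.IsFold m → C.Colorable

/-- The DP-chromatic number: the least positive integer `m` such that every `m`-fold cover of `G`
admits a coloring (`⊤` if there were no such `m`). -/
noncomputable def dpChromaticNumber {V : Type u} (G : SimpleGraph V) : ℕ∞ :=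
  ⨅ m ∈ {m : ℕ | 0 < m ∧ DPColorable G m}, (m : ℕ∞)

/-- `Z_DP(G)`: the least natural number `s` such that the DP-chromatic number and the chromatic
number of the join of `G` with the complete graph on `s` vertices agree (`⊤` if there were no
such `s`). -/
noncomputable def zDPGraph {V : Type u} (G : SimpleGraph V) : ℕ∞ :=
  ⨅ s ∈ {s : ℕ | dpChromaticNumber (join G (⊤ : SimpleGraph (Fin s))) =
    (join G (⊤ : SimpleGraph (Fin s))).chromaticNumber}, (s : ℕ∞)

/-- `Z_DP(n)`: the maximum of `Z_DP(G)` over all graphs `G` of order `n`, that is, up to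
isomorphism, over the finitely many graphs with vertex set `Fin n`. -/
noncomputable def zDP (n : ℕ) : ℕ∞ :=
  ⨆ G : SimpleGraph (Fin n), zDPGraph G

end DPColoring

namespace DPColoring

open Finset
open scoped Classical

universe u

/-! Let n = |V(G)| and k = χ(G). Since χ(G ∨ K_s) = s + k and χ_DP ≥ χ, it suffices to find an
independent transversal in every (s + k)-fold cover when n ≤ 2 or s ≥ n(n - 1). For n ≥ 3 this gives
Z_DP(n) ≤ n(n - 1), which implies the stated bound. Below, U is V(G) with a proper k-colouring and R
is the set of the s vertices ("rows") of K_s.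

The gain at u ∈ U of a partial transversal on A ⊆ R is #A minus the number of elements of L u that
it blocks. If some gain reaches n - p - k + 1, where p is the size of the colour class of u, then u
can be coloured last. A minimal such A has at most 2(n - 1) rows, which is exactly what n(n - 1)
loses when n drops by one, so induction applies (`exists_transversal`).

Otherwise all gains are small. Fix a row a₀, pick a label c_i ∈ L a₀ for each colour i, and give
each u of colour i the neighbour of c_i in L u. If c_i and this neighbour always had the same
neighbours in the other rows, U would block at most k elements per row and a greedy choice would
finish. A transversal of maximal gain forces this up to few exceptions (`adj_of_common_neighbor`,
`card_bad_le`), and the greedy choice tolerates 2s - 3 exceptions in total (`card_le_of_sum_le`).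
Averaging over rows and labels bounds the exceptions (`exists_row`, `exists_cost`). Taking the
colours in some order and in the reverse order, `cost_bound` shows that one of the two orders
succeeds. -/

/-! ### Partial transversals, blocked elements and gain. -/

/-- Between any two different lists, the edges of `H` form a matching. -/
def IsMatched {α W : Type*} (H : SimpleGraph W) (P : Finset α) (L : α → Finset W) : Prop :=
  ∀ p ∈ P, ∀ q ∈ P, p ≠ q → ∀ x ∈ L p, ∀ y ∈ L q, ∀ z ∈ L q, H.Adj x y → H.Adj x z → y = z

/-- `f` is an independent transversal of the lists indexed by `A`. -/
def IsTransversal {α W : Type*} (H : SimpleGraph W) (L : α → Finset W) (A : Finset α)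
    (f : α → W) : Prop :=
  (∀ a ∈ A, f a ∈ L a) ∧ ∀ a ∈ A, ∀ b ∈ A, a ≠ b → ¬ H.Adj (f a) (f b)

/-- The members of `T` with a neighbour in `f '' A`. -/
noncomputable def blocked {α W : Type*} (H : SimpleGraph W) (A : Finset α) (f : α → W)
    (T : Finset W) : Finset W :=
  {y ∈ T | ∃ a ∈ A, H.Adj (f a) y}

/-- The members of `T` without a neighbour in `f '' A`. -/
noncomputable def free {α W : Type*} (H : SimpleGraph W) (A : Finset α) (f : α → W)
    (T : Finset W) : Finset W :=
  {y ∈ T | ∀ a ∈ A, ¬ H.Adj (f a) y}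

/-- Some partial independent transversal of the lists indexed by `S` blocks in `T` at least `g`
elements fewer than it has. -/
def HasGain {α W : Type*} (H : SimpleGraph W) (L : α → Finset W) (S : Finset α) (T : Finset W)
    (g : ℕ) : Prop :=
  ∃ A ⊆ S, ∃ f, IsTransversal H L A f ∧ g + #(blocked H A f T) ≤ #A

variable {α W : Type*} {H : SimpleGraph W} {P A B S R : Finset α} {L : α → Finset W}
  {f : α → W} {T : Finset W}

lemma IsMatched.mono {Q : Finset α} {L' : α → Finset W} (h : IsMatched H P L) (hQ : Q ⊆ P)
    (hL : ∀ p ∈ Q, L' p ⊆ L p) : IsMatched H Q L' :=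
  fun p hp q hq hpq x hx y hy z hz =>
    h p (hQ hp) q (hQ hq) hpq x (hL p hp hx) y (hL q hq hy) z (hL q hq hz)

lemma IsMatched.right {p q : α} (h : IsMatched H P L) (hp : p ∈ P) (hq : q ∈ P) (hpq : p ≠ q)
    {x y z : W} (hx : x ∈ L p) (hy : y ∈ L q) (hz : z ∈ L q) (hxy : H.Adj x y)
    (hxz : H.Adj x z) : y = z :=
  h p hp q hq hpq x hx y hy z hz hxy hxz

lemma IsTransversal.mono {L' : α → Finset W} (h : IsTransversal H L A f) (hB : B ⊆ A)
    (hL : ∀ p ∈ B, L p ⊆ L' p) : IsTransversal H L' B f :=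
  ⟨fun a ha => hL a ha (h.1 a (hB ha)), fun a ha b hb => h.2 a (hB ha) b (hB hb)⟩

lemma mem_blocked {y : W} : y ∈ blocked H A f T ↔ y ∈ T ∧ ∃ a ∈ A, H.Adj (f a) y := by
  simp [blocked]

lemma mem_free {y : W} : y ∈ free H A f T ↔ y ∈ T ∧ ∀ a ∈ A, ¬ H.Adj (f a) y := by
  simp [free]

lemma free_subset : free H A f T ⊆ T := filter_subset _ _

lemma card_blocked_add_card_free : #(blocked H A f T) + #(free H A f T) = #T := by
  rw [← card_filter_add_card_filter_not (s := T) (fun y => ∃ a ∈ A, H.Adj (f a) y)]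
  simp [blocked, free]

lemma card_blocked_le {q : α} (hM : IsMatched H P L) (hA : A ⊆ P) (hf : ∀ a ∈ A, f a ∈ L a)
    (hq : q ∈ P) (hqA : q ∉ A) : #(blocked H A f (L q)) ≤ #A := by
  refine card_le_card_of_forall_subsingleton (fun y a => H.Adj (f a) y) ?_ ?_
  · intro y hy
    exact (mem_blocked.1 hy).2
  · intro a ha y hy z hz
    exact hM.right (hA ha) hq (fun h => hqA (h ▸ ha)) (hf a ha) (mem_blocked.1 hy.1).1
      (mem_blocked.1 hz.1).1 hy.2 hz.2

/-- In a minimal `A` of gain `g`, deleting a row unblocks nothing, so every blocked element is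
blocked at least twice. Each row blocks at most one element, so at most #A / 2 are blocked, and g ≥
#A / 2. -/
lemma exists_subset_card_le_two_mul {g : ℕ} (r : α → W → Prop) (A : Finset α)
    (hr : ∀ a ∈ A, ∀ y ∈ T, ∀ z ∈ T, r a y → r a z → y = z)
    (hg : g + #{y ∈ T | ∃ a ∈ A, r a y} ≤ #A) :
    ∃ A' ⊆ A, g + #{y ∈ T | ∃ a ∈ A', r a y} ≤ #A' ∧ #A' ≤ 2 * g := by
  induction A using Finset.strongInduction with
  | H A ih =>
  by_cases h2 : #A ≤ 2 * g
  · exact ⟨A, Subset.rfl, hg, h2⟩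
  by_cases hex : ∃ a ∈ A, g + #{y ∈ T | ∃ b ∈ A.erase a, r b y} ≤ #(A.erase a)
  · obtain ⟨a, ha, hag⟩ := hex
    obtain ⟨A', hA', h⟩ := ih _ (erase_ssubset ha)
      (fun b hb => hr b (mem_of_mem_erase hb)) hag
    exact ⟨A', hA'.trans (erase_subset _ _), h⟩
  exfalso
  push Not at hex
  have hsub : ∀ a, ({y ∈ T | ∃ b ∈ A.erase a, r b y} : Finset W) ⊆ {y ∈ T | ∃ b ∈ A, r b y} := by
    intro a y hy
    simp only [mem_filter, mem_erase] at hy ⊢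
    obtain ⟨h1, b, ⟨_, h3⟩, h4⟩ := hy
    exact ⟨h1, b, h3, h4⟩
  have hcard : ∀ a ∈ A, #{y ∈ T | ∃ b ∈ A, r b y} ≤ #{y ∈ T | ∃ b ∈ A.erase a, r b y} := by
    intro a ha
    have := hex a ha
    rw [card_erase_of_mem ha] at this
    omega
  -- No single row is needed to block anything; the double count follows.
  have heq := fun a ha => eq_of_subset_of_card_le (hsub a) (hcard a ha)
  have hdc : #{y ∈ T | ∃ b ∈ A, r b y} * 2 ≤ #A * 1 := by
    refine card_mul_le_card_mul (fun y a => r a y) ?_ ?_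
    · intro y hy
      obtain ⟨hyT, a, ha, hay⟩ := by simpa using hy
      rw [← heq a ha] at hy
      obtain ⟨-, b, ⟨hba, hb⟩, hby⟩ := by simpa using hy
      rw [← card_pair hba]
      apply card_le_card
      intro c hc
      simp only [mem_insert, mem_singleton] at hc
      rcases hc with rfl | rfl <;> simp [mem_bipartiteAbove, *]
    · intro a ha
      rw [card_le_one]
      intro y hy z hz
      simp only [mem_bipartiteBelow, mem_filter] at hy hz
      exact hr a ha y hy.1.1 z hz.1.1 hy.2 hz.2
  obtain ⟨a, ha⟩ : A.Nonempty := by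
    rw [← card_pos]; omega
  have h1 := hex a ha
  have h3 := card_le_card (hsub a)
  rw [card_erase_of_mem ha] at h1
  omega

lemma HasGain.exists_small {g : ℕ} {q : α} (hM : IsMatched H P L) (hS : S ⊆ P) (hq : q ∈ P)
    (hqS : q ∉ S) (h : HasGain H L S (L q) g) :
    ∃ A ⊆ S, ∃ f, IsTransversal H L A f ∧ g + #(blocked H A f (L q)) ≤ #A ∧ #A ≤ 2 * g := by
  obtain ⟨A, hA, f, hf, hg⟩ := h
  obtain ⟨A', hA', h1, h2⟩ := exists_subset_card_le_two_mul (T := L q) (g := g)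
    (fun a y => H.Adj (f a) y) A (fun a ha y hy z hz =>
      hM.right (hS (hA ha)) hq (fun h => hqS (h ▸ hA ha)) (hf.1 a ha) hy hz) hg
  exact ⟨A', hA'.trans hA, f, hf.mono hA' (fun _ _ => Subset.rfl), h1, h2⟩

lemma hasGain_zero [Nonempty W] : HasGain H L S T 0 :=
  ⟨∅, empty_subset _, fun _ => Classical.arbitrary W, by simp [IsTransversal], by simp [blocked]⟩

/-- A row without which the top possible gain is lost is moved to `E`; this lowers the ceiling for
the remaining rows by one, whence `#E + m ≤ w`. The process stops when gain `m` survives the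
deletion of any one row. -/
lemma exists_nonessential [Nonempty W] (w : ℕ) (R : Finset α) (h : ¬ HasGain H L R T (w + 1)) :
    ∃ E ⊆ R, ∃ m, #E + m ≤ w ∧ ¬ HasGain H L (R \ E) T (m + 1) ∧
      ∀ a ∈ R \ E, HasGain H L ((R \ E).erase a) T m := by
  induction w generalizing R with
  | zero => exact ⟨∅, empty_subset _, 0, by simp, by simpa using h, fun a _ => hasGain_zero⟩
  | succ w ih =>
    by_cases hall : ∀ a ∈ R, HasGain H L (R.erase a) T (w + 1)
    · exact ⟨∅, empty_subset _, w + 1, by simp, by simpa using h, by simpa using hall⟩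
    push Not at hall
    obtain ⟨a, ha, hna⟩ := hall
    obtain ⟨E, hE, m, h1, h2, h3⟩ := ih _ hna
    have hs : R \ insert a E = R.erase a \ E := by
      ext b; simp only [mem_sdiff, mem_insert, mem_erase]; tauto
    refine ⟨insert a E, insert_subset ha (hE.trans (erase_subset _ _)), m, ?_, ?_, ?_⟩
    · have := card_insert_le a E
      omega
    · rwa [hs]
    · rwa [hs]

lemma IsTransversal.insert_update {b : α} {x : W} (hf : IsTransversal H L A f) (hb : b ∉ A)
    (hx : x ∈ free H A f (L b)) : IsTransversal H L (insert b A) (Function.update f b x) := by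
  have hne : ∀ a ∈ A, a ≠ b := fun a ha h => hb (h ▸ ha)
  rw [mem_free] at hx
  refine ⟨?_, ?_⟩
  · intro a ha
    rcases mem_insert.1 ha with rfl | ha
    · simpa using hx.1
    · simpa [hne a ha] using hf.1 a ha
  · intro a ha c hc hac
    rcases mem_insert.1 ha with rfl | ha' <;> rcases mem_insert.1 hc with rfl | hc'
    · exact absurd rfl hac
    · simpa [hne c hc'] using fun h : H.Adj x (f c) => hx.2 c hc' h.symm
    · simpa [hne a ha'] using hx.2 a ha'
    · simpa [hne a ha', hne c hc'] using hf.2 a ha' c hc' hac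

lemma mem_blocked_insert_update {b : α} {x y : W} (hb : b ∉ A) :
    y ∈ blocked H (insert b A) (Function.update f b x) T ↔
      y ∈ blocked H A f T ∨ y ∈ T ∧ H.Adj x y := by
  have hne : ∀ a ∈ A, a ≠ b := fun a ha h => hb (h ▸ ha)
  simp only [mem_blocked, mem_insert, exists_eq_or_imp, Function.update_self]
  constructor
  · rintro ⟨hy, h | ⟨a, ha, h⟩⟩
    · exact Or.inr ⟨hy, h⟩
    · exact Or.inl ⟨hy, a, ha, by simpa [hne a ha] using h⟩
  · rintro (⟨hy, a, ha, h⟩ | ⟨hy, h⟩)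
    · exact ⟨hy, Or.inr ⟨a, ha, by simpa [hne a ha] using h⟩⟩
    · exact ⟨hy, Or.inl h⟩

/-! ### Consequences of maximal gain. -/

/-- Otherwise adding `x` would block nothing new in `T` and raise the gain. -/
lemma exists_adj_of_mem_free {m : ℕ} (hmax : ¬ HasGain H L S T (m + 1)) (hA : A ⊆ S)
    (hf : IsTransversal H L A f) (hg : m + #(blocked H A f T) ≤ #A) {b : α} (hb : b ∈ S)
    (hbA : b ∉ A) {x : W} (hx : x ∈ free H A f (L b)) : ∃ y ∈ free H A f T, H.Adj x y := by
  by_contra hcon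
  push Not at hcon
  refine hmax ⟨insert b A, insert_subset hb hA, _, hf.insert_update hbA hx, ?_⟩
  have : blocked H (insert b A) (Function.update f b x) T ⊆ blocked H A f T := by
    intro y hy
    rcases (mem_blocked_insert_update hbA).1 hy with h | ⟨h, hxy⟩
    · exact h
    · by_contra hyb
      refine hcon y (mem_free.2 ⟨h, fun a ha hay => hyb (mem_blocked.2 ⟨h, a, ha, hay⟩)⟩) hxy
  have := card_le_card this
  rw [card_insert_of_notMem hbA]
  omega

/-- Otherwise both `x` and `x'` could be added: two more rows, but only `y` newly blocked. -/
lemma adj_of_common_neighbor {m : ℕ} {u : α} (hM : IsMatched H P L) (hS : S ⊆ P) (hu : u ∈ P)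
    (huS : u ∉ S) (hmax : ¬ HasGain H L S (L u) (m + 1)) (hA : A ⊆ S)
    (hf : IsTransversal H L A f) (hg : m + #(blocked H A f (L u)) ≤ #A) {a b : α} (ha : a ∈ S)
    (haA : a ∉ A) (hb : b ∈ S) (hbA : b ∉ A) (hab : a ≠ b) {x x' y : W}
    (hx : x ∈ free H A f (L a)) (hx' : x' ∈ free H A f (L b)) (hy : y ∈ L u) (hxy : H.Adj x y)
    (hx'y : H.Adj x' y) : H.Adj x x' := by
  by_contra hcon
  have hf1 := hf.insert_update haA hx
  have hbA1 : b ∉ insert a A := by simp [hab.symm, hbA]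
  have hx1 : x' ∈ free H (insert a A) (Function.update f a x) (L b) := by
    rw [mem_free] at hx' ⊢
    refine ⟨hx'.1, fun c hc => ?_⟩
    rcases mem_insert.1 hc with rfl | hc
    · simpa using hcon
    · have : c ≠ a := fun h => haA (h ▸ hc)
      simpa [this] using hx'.2 c hc
  refine hmax ⟨_, insert_subset hb (insert_subset ha hA), _, hf1.insert_update hbA1 hx1, ?_⟩
  have : blocked H (insert b (insert a A))
      (Function.update (Function.update f a x) b x') (L u) ⊆ insert y (blocked H A f (L u)) := by
    intro z hz
    rcases (mem_blocked_insert_update hbA1).1 hz with h | ⟨h, hxz⟩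
    · rcases (mem_blocked_insert_update haA).1 h with h | ⟨h, hxz⟩
      · exact mem_insert_of_mem h
      · exact mem_insert.2 (Or.inl (hM.right (hS ha) hu (fun h => huS (h ▸ ha))
          (free_subset hx) h hy hxz hxy))
    · exact mem_insert.2 (Or.inl (hM.right (hS hb) hu (fun h => huS (h ▸ hb))
          (free_subset hx') h hy hxz hx'y))
  have := card_le_card this
  have := card_insert_le y (blocked H A f (L u))
  rw [card_insert_of_notMem hbA1, card_insert_of_notMem haA]
  omega

/-- By maximality `L u` has exactly K - #A + m free elements, while `L b` has at least K - #A, and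
these have distinct neighbours among the former. -/
lemma card_filter_no_free_neighbor_le {m K : ℕ} {u : α} (hM : IsMatched H P L) (hS : S ⊆ P)
    (hu : u ∈ P) (huS : u ∉ S) (hK : ∀ p ∈ P, #(L p) = K)
    (hmax : ¬ HasGain H L S (L u) (m + 1)) (hA : A ⊆ S)
    (hf : IsTransversal H L A f) (hg : m + #(blocked H A f (L u)) ≤ #A) {b : α} (hb : b ∈ S)
    (hbA : b ∉ A) :
    #{y ∈ free H A f (L u) | ∀ x ∈ free H A f (L b), ¬ H.Adj x y} ≤ m := by
  have h1 := card_blocked_add_card_free (H := H) (A := A) (f := f) (T := L u)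
  have h2 := card_blocked_add_card_free (H := H) (A := A) (f := f) (T := L b)
  rw [hK u hu] at h1
  rw [hK b (hS hb)] at h2
  have h3 := card_blocked_le hM (hA.trans hS) hf.1 (hS hb) hbA
  have h4 : #A < m + 1 + #(blocked H A f (L u)) := by
    by_contra h
    exact hmax ⟨A, hA, f, hf, by omega⟩
  have h5 := card_filter_add_card_filter_not (s := free H A f (L u))
    (fun y => ∀ x ∈ free H A f (L b), ¬ H.Adj x y)
  have h6 : #(free H A f (L b)) ≤
      #{y ∈ free H A f (L u) | ¬ ∀ x ∈ free H A f (L b), ¬ H.Adj x y} := by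
    refine card_le_card_of_forall_subsingleton (fun x y => H.Adj x y) ?_ ?_
    · intro x hx
      obtain ⟨y, hy, hxy⟩ := exists_adj_of_mem_free hmax hA hf hg hb hbA hx
      refine ⟨y, mem_filter.2 ⟨hy, ?_⟩, hxy⟩
      push Not
      exact ⟨x, hx, hxy⟩
    · intro y hy x hx z hz
      exact hM.right hu (hS hb) (fun h => huS (h ▸ hb)) (free_subset (mem_filter.1 hy).1)
        (free_subset hx.1) (free_subset hz.1) hx.2.symm hz.2.symm
  omega

/-- Choosing the label `c` for `a₀` and its neighbour in `L u` for `u` blocks in `L b` an element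
that is not a neighbour of `c`. -/
def IsBad (H : SimpleGraph W) (L : α → Finset W) (u b : α) (c : W) : Prop :=
  ∃ y ∈ L u, H.Adj c y ∧ ∃ x ∈ L b, H.Adj y x ∧ ¬ H.Adj c x

/-- Sends a bad `c` injectively to its neighbour in `L u`, which is free and has no free neighbour
in `L b`: `adj_of_common_neighbor` would make such a neighbour adjacent to `c`. -/
lemma card_bad_le {m K : ℕ} {u : α} (hM : IsMatched H P L) (hS : S ⊆ P)
    (hu : u ∈ P) (huS : u ∉ S) (hK : ∀ p ∈ P, #(L p) = K)
    (hmax : ¬ HasGain H L S (L u) (m + 1)) (hA : A ⊆ S)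
    (hf : IsTransversal H L A f) (hg : m + #(blocked H A f (L u)) ≤ #A) {a b : α}
    (ha : a ∈ S) (haA : a ∉ A) (hb : b ∈ S) (hbA : b ∉ A) (hab : a ≠ b) :
    #{c ∈ free H A f (L a) | IsBad H L u b c} ≤ m := by
  refine le_trans ?_ (card_filter_no_free_neighbor_le hM hS hu huS hK hmax hA hf hg hb hbA)
  have hua : u ≠ a := fun h => huS (h ▸ ha)
  have hub : u ≠ b := fun h => huS (h ▸ hb)
  refine card_le_card_of_forall_subsingleton (fun x y => H.Adj x y) ?_ ?_
  · intro c hc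
    obtain ⟨hc, y', hy', hcy', x', hx', hyx', hcx'⟩ := mem_filter.1 hc
    obtain ⟨y, hy, hcy⟩ := exists_adj_of_mem_free hmax hA hf hg ha haA hc
    obtain rfl := hM.right (hS ha) hu hua.symm (free_subset hc) hy' (free_subset hy) hcy' hcy
    refine ⟨y', mem_filter.2 ⟨hy, fun x hx hxy => ?_⟩, hcy⟩
    obtain rfl := hM.right hu (hS hb) hub hy' hx' (free_subset hx) hyx' hxy.symm
    exact hcx' (adj_of_common_neighbor hM hS hu huS hmax hA hf hg ha haA hb hbA hab hc hx hy'
      hcy hxy)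
  · intro y hy x hx z hz
    exact hM.right hu (hS ha) hua (free_subset (mem_filter.1 hy).1)
      (free_subset (mem_filter.1 hx.1).1) (free_subset (mem_filter.1 hz.1).1) hx.2.symm hz.2.symm

/-- Handles rows `b ∈ A` by a second transversal avoiding `a` and `b`: it blocks at most 2m elements
of `L a`, and `card_bad_le` covers the rest. -/
lemma card_bad_le_three_mul {m K : ℕ} {u : α} {A' : Finset α} {f' : α → W}
    (hM : IsMatched H P L) (hS : S ⊆ P)
    (hu : u ∈ P) (huS : u ∉ S) (hK : ∀ p ∈ P, #(L p) = K)
    (hmax : ¬ HasGain H L S (L u) (m + 1)) (hA' : A' ⊆ S)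
    (hf' : IsTransversal H L A' f') (hg' : m + #(blocked H A' f' (L u)) ≤ #A')
    (hA'm : #A' ≤ 2 * m) {a b : α}
    (ha : a ∈ S) (haA : a ∉ A') (hb : b ∈ S) (hbA : b ∉ A') (hab : a ≠ b) :
    #{c ∈ free H A f (L a) | IsBad H L u b c} ≤ 3 * m := by
  have h1 := card_bad_le hM hS hu huS hK hmax hA' hf' hg' ha haA hb hbA hab
  have h2 := card_blocked_le hM (hA'.trans hS) hf'.1 (hS ha) haA
  have h3 : ({c ∈ free H A f (L a) | IsBad H L u b c} : Finset W) ⊆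
      blocked H A' f' (L a) ∪ ({c ∈ free H A' f' (L a) | IsBad H L u b c} : Finset W) := by
    intro c hc
    obtain ⟨hc, hbad⟩ := mem_filter.1 hc
    have := free_subset hc
    rw [mem_union, mem_filter, mem_blocked, mem_free]
    by_cases h : ∃ a ∈ A', H.Adj (f' a) c
    · exact Or.inl ⟨this, h⟩
    · push Not at h
      exact Or.inr ⟨⟨this, h⟩, hbad⟩
  have := card_le_card h3
  have := card_union_le (blocked H A' f' (L a))
    ({c ∈ free H A' f' (L a) | IsBad H L u b c} : Finset W)
  omega

/-! ### Pairs of rows that cannot be avoided together. -/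

/-- No small partial transversal of gain `m` avoids both `a` and `b`. -/
def IsJoint (H : SimpleGraph W) (L : α → Finset W) (S : Finset α) (T : Finset W) (m : ℕ)
    (a b : α) : Prop :=
  ∀ A ⊆ S, ∀ f, IsTransversal H L A f → m + #(blocked H A f T) ≤ #A → #A ≤ 2 * m →
    a ∈ A ∨ b ∈ A

/-- Let A_a be a small transversal's rows avoiding a, and fix s. A joint pair meets A_s; if its
member a lies there, the other one lies in A_a. This leaves at most 2 · 2m · 2m ordered pairs. -/
lemma sum_card_joint_le {m : ℕ}
    (h : ∀ a ∈ S, ∃ A ⊆ S.erase a, ∃ f, IsTransversal H L A f ∧ m + #(blocked H A f T) ≤ #A ∧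
      #A ≤ 2 * m) :
    ∑ a ∈ S, #{b ∈ S | IsJoint H L S T m a b} ≤ 8 * m ^ 2 := by
  rcases S.eq_empty_or_nonempty with rfl | ⟨s, hs⟩
  · simp
  choose! A hA f hf hg hm using h
  have hAS := fun a ha => (hA a ha).trans (erase_subset _ _)
  have key : ∀ a ∈ S, ∀ b, IsJoint H L S T m a b → b ∈ A a := by
    intro a ha b hab
    rcases hab _ (hAS a ha) _ (hf a ha) (hg a ha) (hm a ha) with h | h
    · exact absurd (hA a ha h) (by simp)
    · exact h
  rw [← card_sigma]
  have hsub : (S.sigma fun a => ({b ∈ S | IsJoint H L S T m a b} : Finset α)) ⊆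
      ((A s).sigma fun a => A a) ∪
        ((A s).sigma fun a => A a).map
          ⟨fun p : (_ : α) × α => ⟨p.2, p.1⟩, by rintro ⟨_, _⟩ ⟨_, _⟩ h; simp_all⟩ := by
    rintro ⟨a, b⟩ hab
    simp only [mem_sigma, mem_filter] at hab
    obtain ⟨ha, hb, hJ⟩ := hab
    have hJ' : IsJoint H L S T m b a := fun A hA f hf hg hm => (hJ A hA f hf hg hm).symm
    rcases hJ _ (hAS s hs) _ (hf s hs) (hg s hs) (hm s hs) with h | h
    · exact mem_union_left _ (mem_sigma.2 ⟨h, key a ha b hJ⟩)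
    · refine mem_union_right _ (mem_map.2 ⟨⟨b, a⟩, mem_sigma.2 ⟨h, key b hb a hJ'⟩, rfl⟩)
  have hc : #((A s).sigma fun a => A a) ≤ 2 * m * (2 * m) := by
    rw [card_sigma]
    calc ∑ a ∈ A s, #(A a) ≤ ∑ a ∈ A s, 2 * m := sum_le_sum fun a ha => hm a (hAS s hs ha)
      _ = #(A s) * (2 * m) := by simp
      _ ≤ _ := Nat.mul_le_mul_right _ (hm s hs)
  refine (card_le_card hsub).trans ((card_union_le _ _).trans ?_)
  rw [card_map]
  nlinarith

/-! ### Gluing and greedy completion. -/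

lemma IsTransversal.glue {g : α → W} (hf : IsTransversal H L A f)
    (hg : IsTransversal H (fun p => free H A f (L p)) B g) (hAB : Disjoint A B) :
    ∃ h, IsTransversal H L (A ∪ B) h ∧ (∀ a ∈ A, h a = f a) ∧ ∀ b ∈ B, h b = g b := by
  have hB : ∀ b ∈ B, b ∉ A := fun b hb hA => disjoint_left.1 hAB hA hb
  have hx : ∀ a ∈ A, ∀ b ∈ B, ¬ H.Adj (f a) (g b) := fun a ha b hb =>
    (mem_free.1 (hg.1 b hb)).2 a ha
  refine ⟨fun p => if p ∈ A then f p else g p, ⟨?_, ?_⟩, ?_, ?_⟩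
  · intro p hp
    rcases mem_union.1 hp with hp | hp
    · simpa [hp] using hf.1 p hp
    · simpa [hB p hp] using free_subset (hg.1 p hp)
  · intro p hp q hq hpq
    rcases mem_union.1 hp with hp | hp <;> rcases mem_union.1 hq with hq | hq
    · simpa [hp, hq] using hf.2 p hp q hq hpq
    · simpa [hp, hB q hq] using hx p hp q hq
    · simpa [hB p hp, hq] using fun h : H.Adj (g p) (f q) => hx q hq p hp h.symm
    · simpa [hB p hp, hB q hq] using hg.2 p hp q hq hpq
  · intro a ha
    simp [ha]
  · intro b hb
    simp [hB b hb]

lemma isTransversal_singleton {a : α} {x : W} (hx : x ∈ L a) :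
    IsTransversal H L {a} fun _ => x :=
  ⟨fun b hb => by rwa [mem_singleton.1 hb],
    fun b hb c hc hbc => absurd ((mem_singleton.1 hb).trans (mem_singleton.1 hc).symm) hbc⟩

lemma card_le_card_free_add {q : α} (hM : IsMatched H P L) (hA : A ⊆ P)
    (hf : ∀ a ∈ A, f a ∈ L a) (hq : q ∈ P) (hqA : q ∉ A) :
    #(L q) ≤ #(free H A f (L q)) + #A := by
  have h1 := card_blocked_add_card_free (H := H) (A := A) (f := f) (T := L q)
  have h2 := card_blocked_le hM hA hf hq hqA
  omega

/-- Greedy choice: the lists with the largest defect are treated first. -/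
lemma exists_transversal_of_defect [Nonempty W] (R : Finset α) (L : α → Finset W) (ex : α → ℕ)
    (hM : IsMatched H R L) (hL : ∀ a ∈ R, #R ≤ #(L a) + ex a)
    (hex : ∀ a ∈ R, #{b ∈ R | ex a ≤ ex b} + ex a ≤ #R) : ∃ f, IsTransversal H L R f := by
  induction hn : #R generalizing R L with
  | zero =>
    rw [card_eq_zero] at hn
    exact ⟨fun _ => Classical.arbitrary W, by simp [IsTransversal, hn]⟩
  | succ n ih =>
    have hne : R.Nonempty := by rw [← card_pos]; omega
    obtain ⟨a, ha, hmax⟩ := exists_max_image R ex hne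
    have h1 := hL a ha
    have h2 := hex a ha
    have h3 : 0 < #{b ∈ R | ex a ≤ ex b} := card_pos.2 ⟨a, by simp [ha]⟩
    obtain ⟨x, hx⟩ : (L a).Nonempty := by rw [← card_pos]; omega
    have hcard : #(R.erase a) = n := by rw [card_erase_of_mem ha]; omega
    have hsing := isTransversal_singleton (H := H) hx
    obtain ⟨g, hg⟩ := ih (R.erase a) (fun p => free H {a} (fun _ => x) (L p))
      (hM.mono (erase_subset _ _) fun p _ => free_subset) (fun b hb => by
        obtain ⟨hba, hb⟩ := mem_erase.1 hb
        have h4 := card_le_card_free_add hM (singleton_subset_iff.2 ha) hsing.1 hb (by simpa)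
        have h5 := hL b hb
        rw [card_singleton] at h4
        omega) (fun b hb => by
        obtain ⟨hba, hb⟩ := mem_erase.1 hb
        have h4 := hex b hb
        have h5 : ({c ∈ R.erase a | ex b ≤ ex c} : Finset α) =
            ({c ∈ R | ex b ≤ ex c} : Finset α).erase a := by
          ext c; simp only [mem_filter, mem_erase]; tauto
        have h6 : a ∈ ({c ∈ R | ex b ≤ ex c} : Finset α) := by simp [ha, hmax b hb]
        rw [h5, card_erase_of_mem h6]
        have := card_pos.2 ⟨a, h6⟩
        omega) hcard
    obtain ⟨h, hh, -⟩ := hsing.glue hg (by simp)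
    rw [← insert_eq, insert_erase ha] at hh
    exact ⟨h, hh⟩

/-- If j = `ex a` ≥ 2 violated the claim, at least #R - j + 1 rows would have defect at least j. By
concavity (#R - j + 1) j ≥ 2#R - 2 for 2 ≤ j < #R, which exceeds the sum. For j = 1 the row `a₀`
provides the slack. -/
lemma card_le_of_sum_le {ex : α → ℕ} {a₀ : α} (ha₀ : a₀ ∈ R) (h0 : ex a₀ = 0)
    (hlt : ∀ a ∈ R, ex a < #R) (hsum : ∑ a ∈ R, ex a + 3 ≤ 2 * #R) :
    ∀ a ∈ R, #{b ∈ R | ex a ≤ ex b} + ex a ≤ #R := by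
  intro a ha
  have h1 : #{b ∈ R | ex a ≤ ex b} * ex a ≤ ∑ b ∈ R, ex b := by
    calc _ = ∑ b ∈ R with ex a ≤ ex b, ex a := by simp
      _ ≤ ∑ b ∈ R with ex a ≤ ex b, ex b := sum_le_sum fun b hb => (mem_filter.1 hb).2
      _ ≤ _ := sum_le_sum_of_subset (filter_subset _ _)
  have h2 := hlt a ha
  have h3 : #{b ∈ R | ex a ≤ ex b} ≤ #R := card_filter_le _ _
  by_contra hcon
  rcases Nat.lt_or_ge (ex a) 2 with hj | hj
  · have : 0 < ex a := by omega
    have h4 : ({b ∈ R | ex a ≤ ex b} : Finset α) ⊆ R.erase a₀ := by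
      intro b hb
      obtain ⟨hb, hab⟩ := mem_filter.1 hb
      refine mem_erase.2 ⟨fun h => ?_, hb⟩
      subst h; omega
    have := card_le_card h4
    rw [card_erase_of_mem ha₀] at this
    have := card_pos.2 ⟨a₀, ha₀⟩
    omega
  · obtain ⟨i, hi⟩ := Nat.exists_eq_add_of_le hj
    obtain ⟨l, hl⟩ := Nat.exists_eq_add_of_lt h2
    have h5 : l + 2 ≤ #{b ∈ R | ex a ≤ ex b} := by omega
    have h6 := Nat.mul_le_mul_right (ex a) h5
    have h7 : 2 * (i + l) + 4 ≤ (l + 2) * ex a := by rw [hi]; nlinarith [Nat.zero_le (l * i)]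
    omega

/-! ### Choosing one label per colour. -/

lemma exists_sequence {k : ℕ} {β : Type*} [Nonempty β] (Q : Fin k → (Fin k → β) → β → Prop)
    (hQ : ∀ j c c' x, (∀ i < j, c i = c' i) → Q j c x → Q j c' x)
    (hex : ∀ j c, (∀ i < j, Q i c (c i)) → ∃ x, Q j c x) : ∃ c, ∀ j, Q j c (c j) := by
  have key : ∀ m ≤ k, ∃ c : Fin k → β, ∀ j : Fin k, j.val < m → Q j c (c j) := by
    intro m
    induction m with
    | zero => exact fun _ => ⟨fun _ => Classical.arbitrary β, fun j hj => by omega⟩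
    | succ m ih =>
      intro hm
      obtain ⟨c, hc⟩ := ih (by omega)
      obtain ⟨x, hx⟩ := hex ⟨m, hm⟩ c fun i hi => hc i hi
      have hlt : ∀ i : Fin k, i < ⟨m, hm⟩ → c i = Function.update c ⟨m, hm⟩ x i :=
        fun i hi => by rw [Function.update_of_ne hi.ne]
      refine ⟨Function.update c ⟨m, hm⟩ x, fun j hj => ?_⟩
      rcases Nat.lt_succ_iff_lt_or_eq.1 hj with h | h
      · rw [← hlt j h]
        exact hQ j c _ _ (fun i hi => hlt i (hi.trans h)) (hc j h)
      · obtain rfl : j = ⟨m, hm⟩ := Fin.ext h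
        rw [Function.update_self]
        exact hQ _ c _ _ hlt hx
  obtain ⟨c, hc⟩ := key k le_rfl
  exact ⟨c, fun j => hc j j.2⟩

/-- Labels are chosen colour by colour. For colour `i`, each `u` excludes at most `2 * m u` labels
outside `ok u`, and each pair of `u` with an earlier-coloured `v` excludes at most one. At least `q
i` labels remain, and one of them has at most average cost. -/
lemma exists_labels [Nonempty W] {k : ℕ} {U : Finset α} {a₀ : α} (col : α → Fin k)
    (ha₀ : a₀ ∉ U) (hM : IsMatched H (insert a₀ U) L) (ok : α → Finset W) (m B : α → ℕ)
    (g : α → W → ℕ) (q : Fin k → ℕ) (hq0 : ∀ i, 0 < q i)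
    (hok : ∀ u ∈ U, #(L a₀ \ ok u) ≤ 2 * m u)
    (hq : ∀ i, q i + ∑ u ∈ U with col u = i, 2 * m u +
      #{u ∈ U | col u = i} * #{v ∈ U | col v < i} ≤ #(L a₀))
    (hg : ∀ u ∈ U, ∑ c ∈ ok u, g u c ≤ B u) :
    ∃ c : Fin k → W, (∀ i, c i ∈ L a₀) ∧ (∀ u ∈ U, c (col u) ∈ ok u) ∧
      (∀ u ∈ U, ∀ v ∈ U, col u ≠ col v → ∀ y ∈ L u, ∀ z ∈ L v, H.Adj (c (col u)) y →
        H.Adj (c (col v)) z → ¬ H.Adj y z) ∧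
      ∀ i, q i * ∑ u ∈ U with col u = i, g u (c i) ≤ ∑ u ∈ U with col u = i, B u := by
  have hne : ∀ u ∈ U, u ≠ a₀ := fun u hu h => ha₀ (h ▸ hu)
  let Q : Fin k → (Fin k → W) → W → Prop := fun j c x =>
    x ∈ L a₀ ∧ (∀ u ∈ U, col u = j → x ∈ ok u) ∧
    (∀ u ∈ U, col u = j → ∀ v ∈ U, col v < j → ∀ y ∈ L u, ∀ z ∈ L v, H.Adj x y →
      H.Adj (c (col v)) z → ¬ H.Adj y z) ∧
    q j * ∑ u ∈ U with col u = j, g u x ≤ ∑ u ∈ U with col u = j, B u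
  suffices h : ∃ c, ∀ j, Q j c (c j) by
    obtain ⟨c, hc⟩ := h
    refine ⟨c, fun i => (hc i).1, fun u hu => (hc _).2.1 u hu rfl, ?_, fun i => (hc i).2.2.2⟩
    intro u hu v hv huv y hy z hz h1 h2
    rcases lt_or_gt_of_ne huv with h | h
    · exact fun h3 => (hc _).2.2.1 v hv rfl u hu h z hz y hy h2 h1 h3.symm
    · exact (hc _).2.2.1 u hu rfl v hv h y hy z hz h1 h2
  refine exists_sequence Q ?_ ?_
  · rintro j c c' x hcc ⟨h1, h2, h3, h4⟩
    refine ⟨h1, h2, fun u hu huj v hv hvj y hy z hz hxy hcz => ?_, h4⟩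
    exact h3 u hu huj v hv hvj y hy z hz hxy (by rwa [hcc _ hvj])
  · intro j c hc
    set T : Finset W := {x ∈ L a₀ | (∀ u ∈ U, col u = j → x ∈ ok u) ∧
      ∀ u ∈ U, col u = j → ∀ v ∈ U, col v < j → ∀ y ∈ L u, ∀ z ∈ L v, H.Adj x y →
        H.Adj (c (col v)) z → ¬ H.Adj y z} with hT
    -- The label of `v` determines `z`, which determines `y`, which determines `x`.
    have hconf : ∀ u ∈ U, col u = j → ∀ v ∈ U, col v < j →
        #{x ∈ L a₀ | ∃ y ∈ L u, ∃ z ∈ L v, H.Adj x y ∧ H.Adj (c (col v)) z ∧ H.Adj y z} ≤ 1 := by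
      intro u hu huj v hv hvj
      rw [card_le_one]
      intro x hx x' hx'
      obtain ⟨hx, y, hy, z, hz, h1, h2, h3⟩ := mem_filter.1 hx
      obtain ⟨hx', y', hy', z', hz', h1', h2', h3'⟩ := mem_filter.1 hx'
      have huP := mem_insert_of_mem (a := u) (b := a₀) hu
      have hvP := mem_insert_of_mem (a := v) (b := a₀) hv
      have haP := mem_insert_self a₀ U
      obtain rfl := hM.right haP hvP (hne v hv).symm (hc _ hvj).1 hz hz' h2 h2'
      have huv : v ≠ u := fun h => by subst h; exact hvj.ne huj
      obtain rfl := hM.right hvP huP huv hz hy hy' h3.symm h3'.symm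
      exact hM.right huP haP (hne u hu) hy hx hx' h1.symm h1'.symm
    have hsub : L a₀ ⊆ T ∪ ({u ∈ U | col u = j} : Finset α).biUnion fun u => (L a₀ \ ok u) ∪
        ({v ∈ U | col v < j} : Finset α).biUnion fun v =>
          {x ∈ L a₀ | ∃ y ∈ L u, ∃ z ∈ L v, H.Adj x y ∧ H.Adj (c (col v)) z ∧ H.Adj y z} := by
      intro x hx
      by_cases h : x ∈ T
      · exact mem_union_left _ h
      refine mem_union_right _ ?_
      rw [hT, mem_filter] at h
      simp only [hx, true_and, not_and_or] at h
      simp only [mem_biUnion, mem_union, mem_filter, mem_sdiff]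
      rcases h with h | h
      · push Not at h
        obtain ⟨u, hu, huj, h⟩ := h
        exact ⟨u, ⟨hu, huj⟩, Or.inl ⟨hx, h⟩⟩
      · push Not at h
        obtain ⟨u, hu, huj, v, hv, hvj, y, hy, z, hz, h1, h2, h3⟩ := h
        exact ⟨u, ⟨hu, huj⟩, Or.inr ⟨v, ⟨hv, hvj⟩, hx, y, hy, z, hz, h1, h2, h3⟩⟩
    have hqT : q j ≤ #T := by
      have h1 := (card_le_card hsub).trans ((card_union_le _ _).trans
        (Nat.add_le_add_left card_biUnion_le _))
      have h2 : ∑ u ∈ U with col u = j, #((L a₀ \ ok u) ∪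
        ({v ∈ U | col v < j} : Finset α).biUnion fun v =>
          {x ∈ L a₀ | ∃ y ∈ L u, ∃ z ∈ L v, H.Adj x y ∧ H.Adj (c (col v)) z ∧ H.Adj y z}) ≤
          ∑ u ∈ U with col u = j, (2 * m u + #{v ∈ U | col v < j}) := by
        refine sum_le_sum fun u hu => ?_
        obtain ⟨hu, huj⟩ := mem_filter.1 hu
        refine (card_union_le _ _).trans (Nat.add_le_add (hok u hu) ?_)
        refine card_biUnion_le.trans ((sum_le_card_nsmul _ _ 1 ?_).trans (by simp))
        intro v hv
        obtain ⟨hv, hvj⟩ := mem_filter.1 hv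
        exact hconf u hu huj v hv hvj
      rw [sum_add_distrib, sum_const, smul_eq_mul] at h2
      have := hq j
      omega
    have hsum : ∑ x ∈ T, ∑ u ∈ U with col u = j, g u x ≤ ∑ u ∈ U with col u = j, B u := by
      rw [sum_comm]
      refine sum_le_sum fun u hu => ?_
      obtain ⟨hu, huj⟩ := mem_filter.1 hu
      refine le_trans (sum_le_sum_of_subset fun x hx => ?_) (hg u hu)
      exact (mem_filter.1 hx).2.1 u hu huj
    obtain ⟨x, hx, hxq⟩ : ∃ x ∈ T, q j * ∑ u ∈ U with col u = j, g u x ≤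
        ∑ u ∈ U with col u = j, B u := by
      by_contra hcon
      push Not at hcon
      have hTne : T.Nonempty := by rw [← card_pos]; have := hq0 j; omega
      have h1 := sum_lt_sum_of_nonempty hTne hcon
      rw [sum_const, smul_eq_mul, ← mul_sum] at h1
      have h2 := Nat.mul_le_mul hqT hsum
      have h3 := Nat.mul_le_mul_left (q j) hsum
      have h4 := Nat.mul_le_mul_right (∑ u ∈ U with col u = j, B u) hqT
      omega
    exact ⟨x, (mem_filter.1 hx).1, (mem_filter.1 hx).2.1, (mem_filter.1 hx).2.2, hxq⟩

/-- In `L a₀` the set U blocks only the k labels. In another row it blocks at most the k neighbours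
of the labels and one element per bad `u`, so the defect is the number of bad `u`. -/
lemma exists_transversal_of_labels {k : ℕ} {U : Finset α} (hUR : Disjoint U R)
    (hM : IsMatched H (U ∪ R) L) (hK : ∀ p ∈ U ∪ R, #(L p) = #R + k) (hcard : #U < #R)
    (col : α → Fin k)
    (hcol : ∀ u ∈ U, ∀ v ∈ U, u ≠ v → col u = col v → ∀ x ∈ L u, ∀ y ∈ L v, ¬ H.Adj x y)
    {a₀ : α} (ha₀ : a₀ ∈ R) (c : Fin k → W) (hc : ∀ i, c i ∈ L a₀) (y : α → W)
    (hy : ∀ u ∈ U, y u ∈ L u) (hcy : ∀ u ∈ U, H.Adj (c (col u)) (y u))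
    (hind : ∀ u ∈ U, ∀ v ∈ U, col u ≠ col v → ¬ H.Adj (y u) (y v))
    (hX : ∑ u ∈ U, #{b ∈ R.erase a₀ | IsBad H L u b (c (col u))} + 3 ≤ 2 * #R) :
    ∃ f, IsTransversal H L (U ∪ R) f := by
  have : Nonempty W := ⟨y a₀⟩
  have hUP : U ⊆ U ∪ R := subset_union_left
  have hRP : R ⊆ U ∪ R := subset_union_right
  have hdisj : ∀ u ∈ U, u ∉ R := fun u hu h => disjoint_left.1 hUR hu h
  have hyT : IsTransversal H L U y := by
    refine ⟨hy, fun u hu v hv huv => ?_⟩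
    by_cases h : col u = col v
    · exact hcol u hu v hv huv h _ (hy u hu) _ (hy v hv)
    · exact hind u hu v hv h
  set ex : α → ℕ := fun b => if b = a₀ then 0 else #{u ∈ U | IsBad H L u b (c (col u))} with hexd
  have hex0 : ex a₀ = 0 := by simp [hexd]
  have hexU : ∀ b, ex b ≤ #U := by
    intro b
    simp only [hexd]
    split_ifs
    · exact Nat.zero_le _
    · exact card_filter_le _ _
  have hblk : ∀ b ∈ R, #(blocked H U y (L b)) ≤ k + ex b := by
    intro b hb
    have hbU : b ∉ U := fun h => hdisj b h hb
    by_cases hba : b = a₀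
    · subst hba
      have : blocked H U y (L b) ⊆ univ.image c := by
        intro x hx
        obtain ⟨hx, u, hu, hux⟩ := mem_blocked.1 hx
        refine mem_image.2 ⟨col u, mem_univ _, ?_⟩
        exact hM.right (hUP hu) (hRP hb) (fun h => hbU (h ▸ hu)) (hy u hu) (hc _) hx
          (hcy u hu).symm hux
      refine (card_le_card this).trans (card_image_le.trans ?_)
      simp
    · have hexb : ex b = #{u ∈ U | IsBad H L u b (c (col u))} := by simp [hexd, hba]
      have hsub : blocked H U y (L b) ⊆ ({x ∈ L b | ∃ i, H.Adj (c i) x} : Finset W) ∪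
          blocked H ({u ∈ U | IsBad H L u b (c (col u))} : Finset α) y (L b) := by
        intro x hx
        obtain ⟨hx, u, hu, hux⟩ := mem_blocked.1 hx
        by_cases h : H.Adj (c (col u)) x
        · exact mem_union_left _ (mem_filter.2 ⟨hx, _, h⟩)
        · exact mem_union_right _ (mem_blocked.2 ⟨hx, u, mem_filter.2 ⟨hu, y u, hy u hu,
            hcy u hu, x, hx, hux, h⟩, hux⟩)
      have h1 : #{x ∈ L b | ∃ i, H.Adj (c i) x} ≤ #(univ : Finset (Fin k)) := by
        refine card_le_card_of_forall_subsingleton (fun x i => H.Adj (c i) x) ?_ ?_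
        · intro x hx
          obtain ⟨-, i, hi⟩ := mem_filter.1 hx
          exact ⟨i, mem_univ _, hi⟩
        · intro i _ x hx z hz
          exact hM.right (hRP ha₀) (hRP hb) (Ne.symm hba) (hc i) (mem_filter.1 hx.1).1
            (mem_filter.1 hz.1).1 hx.2 hz.2
      have h2 := card_blocked_le (A := ({u ∈ U | IsBad H L u b (c (col u))} : Finset α)) (f := y)
        hM ((filter_subset _ _).trans hUP) (fun u hu => hy u (mem_filter.1 hu).1) (hRP hb)
        (fun h => hbU (mem_filter.1 h).1)
      have h3 := (card_le_card hsub).trans (card_union_le _ _)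
      rw [card_univ, Fintype.card_fin] at h1
      omega
  obtain ⟨g, hg⟩ := exists_transversal_of_defect R (fun p => free H U y (L p)) ex
    (hM.mono hRP fun p _ => free_subset) (fun b hb => by
      have h1 := hblk b hb
      have h2 := card_blocked_add_card_free (H := H) (A := U) (f := y) (T := L b)
      rw [hK b (hRP hb)] at h2
      omega) (by
      refine card_le_of_sum_le ha₀ hex0 (fun b _ => (hexU b).trans_lt hcard) ?_
      rw [← add_sum_erase _ _ ha₀, hex0, zero_add]
      have : ∑ b ∈ R.erase a₀, ex b = ∑ u ∈ U, #{b ∈ R.erase a₀ | IsBad H L u b (c (col u))} := by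
        simp_rw [card_filter]
        rw [sum_comm]
        refine sum_congr rfl fun b hb => ?_
        simp [hexd, ne_of_mem_erase hb]
      rwa [this])
  obtain ⟨h, hh, -⟩ := hyT.glue hg hUR
  exact ⟨h, hh⟩

/-- Rows in `E u` and rows joint with `a₀` are simply counted as bad. Only the remaining rows are
averaged over the labels, and `g u` is their number of bad ones. -/
lemma exists_cost {k : ℕ} {U : Finset α} (hUR : Disjoint U R)
    (hM : IsMatched H (U ∪ R) L) (hK : ∀ p ∈ U ∪ R, #(L p) = #R + k) (hcard : #U < #R)
    (col : α → Fin k)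
    (hcol : ∀ u ∈ U, ∀ v ∈ U, u ≠ v → col u = col v → ∀ x ∈ L u, ∀ y ∈ L v, ¬ H.Adj x y)
    (E : α → Finset α) (m : α → ℕ)
    (hmax : ∀ u ∈ U, ¬ HasGain H L (R \ E u) (L u) (m u + 1))
    (hgain : ∀ u ∈ U, ∀ a ∈ R \ E u, HasGain H L ((R \ E u).erase a) (L u) (m u))
    {a₀ : α} (ha₀ : a₀ ∈ R) (ha₀E : ∀ u ∈ U, a₀ ∉ E u) (q : Fin k → ℕ) (hq0 : ∀ i, 0 < q i)
    (hq : ∀ i, q i + ∑ u ∈ U with col u = i, 2 * m u +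
      #{u ∈ U | col u = i} * #{v ∈ U | col v < i} ≤ #R + k) :
    ∃ g : α → ℕ, (∀ i, q i * ∑ u ∈ U with col u = i, g u ≤
        ∑ u ∈ U with col u = i, m u * (#R + 4 * m u)) ∧
      (∑ u ∈ U, (#(E u) + #{b ∈ R \ E u | IsJoint H L (R \ E u) (L u) (m u) a₀ b} + g u) + 3 ≤
        2 * #R → ∃ f, IsTransversal H L (U ∪ R) f) := by
  have hUP : U ⊆ U ∪ R := subset_union_left
  have hRP : R ⊆ U ∪ R := subset_union_right
  have hSP : ∀ u, R \ E u ⊆ U ∪ R := fun u => sdiff_subset.trans hRP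
  have hdisj : ∀ u ∈ U, u ∉ R := fun u hu h => disjoint_left.1 hUR hu h
  have huS : ∀ u ∈ U, u ∉ R \ E u := fun u hu h => hdisj u hu (mem_sdiff.1 h).1
  have haS : ∀ u ∈ U, a₀ ∈ R \ E u := fun u hu => mem_sdiff.2 ⟨ha₀, ha₀E u hu⟩
  have hKa : #(L a₀) = #R + k := hK a₀ (hRP ha₀)
  obtain ⟨x₀, -⟩ : (L a₀).Nonempty := by rw [← card_pos]; omega
  have : Nonempty W := ⟨x₀⟩
  have hsmall := fun u hu => (hgain u hu a₀ (haS u hu)).exists_small hM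
    ((erase_subset _ _).trans (hSP u)) (hUP hu) (fun h => huS u hu (mem_of_mem_erase h))
  choose! A hA f hf hg hm using hsmall
  have hAS : ∀ u ∈ U, A u ⊆ R \ E u := fun u hu => (hA u hu).trans (erase_subset _ _)
  have haA : ∀ u ∈ U, a₀ ∉ A u := fun u hu h => by simpa using hA u hu h
  set N : α → Finset α := fun u =>
    {b ∈ (R \ E u).erase a₀ | ¬ IsJoint H L (R \ E u) (L u) (m u) a₀ b} with hN
  set ok : α → Finset W := fun u => free H (A u) (f u) (L a₀) with hokd
  have hB : ∀ u ∈ U, ∑ c ∈ ok u, #{b ∈ N u | IsBad H L u b c} ≤ m u * (#R + 4 * m u) := by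
    intro u hu
    have h1 : ∑ c ∈ ok u, #{b ∈ N u | IsBad H L u b c} =
        ∑ b ∈ N u, #{c ∈ ok u | IsBad H L u b c} := by
      simp_rw [card_filter]
      rw [sum_comm]
    -- At most 2m rows lie in `A u`, and only they cost the extra 2m; this gives the term 4m².
    have h2 : ∀ b ∈ N u, #{c ∈ ok u | IsBad H L u b c} ≤
        m u + if b ∈ A u then 2 * m u else 0 := by
      intro b hb
      obtain ⟨hb, hJ⟩ := mem_filter.1 hb
      obtain ⟨hba, hbS⟩ := mem_erase.1 hb
      split_ifs with hbA
      · unfold IsJoint at hJ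
        push Not at hJ
        obtain ⟨A', hA', f', hf', hg', hm', haA', hbA'⟩ := hJ
        have := card_bad_le_three_mul (A := A u) (f := f u) hM (hSP u) (hUP hu) (huS u hu) hK
          (hmax u hu) hA' hf' hg' hm' (haS u hu) haA' hbS hbA' hba.symm
        simp only [hokd]
        omega
      · exact card_bad_le hM (hSP u) (hUP hu) (huS u hu) hK (hmax u hu) (hAS u hu) (hf u hu)
          (hg u hu) (haS u hu) (haA u hu) hbS hbA hba.symm
    rw [h1]
    refine (sum_le_sum h2).trans ?_
    rw [sum_add_distrib, sum_const, smul_eq_mul, ← sum_filter, sum_const, smul_eq_mul]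
    have h3 : #(N u) ≤ #R := card_le_card
      ((filter_subset _ _).trans ((erase_subset _ _).trans sdiff_subset))
    have h4 : #{b ∈ N u | b ∈ A u} ≤ 2 * m u :=
      (card_le_card fun b hb => (mem_filter.1 hb).2).trans (hm u hu)
    have h5 := Nat.mul_le_mul_right (m u) h3
    have h6 := Nat.mul_le_mul_right (2 * m u) h4
    nlinarith
  obtain ⟨c, hc1, hc2, hc3, hc4⟩ := exists_labels (L := L) (H := H) (U := U) (a₀ := a₀) col
    (fun h => hdisj _ h ha₀)
    (hM.mono (insert_subset (hRP ha₀) hUP) fun _ _ => Subset.rfl) ok m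
    (fun u => m u * (#R + 4 * m u)) (fun u c => #{b ∈ N u | IsBad H L u b c}) q hq0
    (fun u hu => by
      have h1 := card_le_card_free_add hM ((hAS u hu).trans (hSP u)) (hf u hu).1 (hRP ha₀)
        (haA u hu)
      have h2 := card_sdiff_add_card_eq_card
        (free_subset : free H (A u) (f u) (L a₀) ⊆ L a₀)
      have h3 := hm u hu
      simp only [hokd]
      omega) (by simpa only [hKa] using hq) hB
  have hy := fun u hu => exists_adj_of_mem_free (hmax u hu) (hAS u hu) (hf u hu) (hg u hu)
    (haS u hu) (haA u hu) (hc2 u hu)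
  choose! y hy hcy using hy
  refine ⟨fun u => #{b ∈ N u | IsBad H L u b (c (col u))}, fun i => ?_, fun hX => ?_⟩
  · refine le_trans (le_of_eq ?_) (hc4 i)
    congr 1
    refine sum_congr rfl fun u hu => ?_
    simp only [(mem_filter.1 hu).2]
  · refine exists_transversal_of_labels hUR hM hK hcard col hcol ha₀ c hc1 y
      (fun u hu => free_subset (hy u hu)) hcy (fun u hu v hv huv => hc3 u hu v hv huv _
        (free_subset (hy u hu)) _ (free_subset (hy v hv)) (hcy u hu) (hcy v hv)) ?_
    refine le_trans (Nat.add_le_add_right (sum_le_sum fun u hu => ?_) 3) hX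
    have : ({b ∈ R.erase a₀ | IsBad H L u b (c (col u))} : Finset α) ⊆
        (E u ∪ ({b ∈ R \ E u | IsJoint H L (R \ E u) (L u) (m u) a₀ b} : Finset α)) ∪
          ({b ∈ N u | IsBad H L u b (c (col u))} : Finset α) := by
      intro b hb
      simp only [hN, mem_union, mem_filter, mem_erase, mem_sdiff] at hb ⊢
      tauto
    refine (card_le_card this).trans ((card_union_le _ _).trans ?_)
    exact Nat.add_le_add_right (card_union_le _ _) _

/-- Averages the number of joint partners over the rows outside every `E u`. -/
lemma exists_row {U : Finset α} (hUR : Disjoint U R)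
    (hM : IsMatched H (U ∪ R) L) (E : α → Finset α) (m : α → ℕ)
    (hgain : ∀ u ∈ U, ∀ a ∈ R \ E u, HasGain H L ((R \ E u).erase a) (L u) (m u))
    (hE : ∑ u ∈ U, #(E u) < #R) :
    ∃ a₀ ∈ R, (∀ u ∈ U, a₀ ∉ E u) ∧ (#R - ∑ u ∈ U, #(E u)) *
      ∑ u ∈ U, #{b ∈ R \ E u | IsJoint H L (R \ E u) (L u) (m u) a₀ b} ≤
        ∑ u ∈ U, 8 * m u ^ 2 := by
  have hUP : U ⊆ U ∪ R := subset_union_left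
  have hRP : R ⊆ U ∪ R := subset_union_right
  set Q := R \ U.biUnion E with hQ
  have hQc : #R - ∑ u ∈ U, #(E u) ≤ #Q := by
    have h1 : #R - #(U.biUnion E) ≤ #Q := le_card_sdiff _ _
    have h2 : #(U.biUnion E) ≤ ∑ u ∈ U, #(E u) := card_biUnion_le
    omega
  have hQS : ∀ u ∈ U, Q ⊆ R \ E u := fun u hu a ha => by
    simp only [hQ, mem_sdiff, mem_biUnion, not_exists, not_and] at ha ⊢
    exact ⟨ha.1, ha.2 u hu⟩
  have hsum : ∑ a ∈ Q, ∑ u ∈ U, #{b ∈ R \ E u | IsJoint H L (R \ E u) (L u) (m u) a b} ≤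
      ∑ u ∈ U, 8 * m u ^ 2 := by
    rw [sum_comm]
    refine sum_le_sum fun u hu => (sum_le_sum_of_subset (hQS u hu)).trans ?_
    refine sum_card_joint_le fun a ha => ?_
    refine (hgain u hu a ha).exists_small hM
      ((erase_subset _ _).trans (sdiff_subset.trans hRP)) (hUP hu) fun h => ?_
    exact disjoint_left.1 hUR hu (mem_sdiff.1 (mem_of_mem_erase h)).1
  have hQne : Q.Nonempty := by rw [← card_pos]; omega
  obtain ⟨a, ha, hle⟩ := exists_le_of_sum_le (f := fun a => #Q *
    ∑ u ∈ U, #{b ∈ R \ E u | IsJoint H L (R \ E u) (L u) (m u) a b})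
    (g := fun _ => ∑ u ∈ U, 8 * m u ^ 2) hQne (by
      rw [← mul_sum, sum_const, smul_eq_mul]
      exact Nat.mul_le_mul_left _ hsum)
  refine ⟨a, (mem_sdiff.1 ha).1, fun u hu => (mem_sdiff.1 (hQS u hu ha)).2, ?_⟩
  exact (Nat.mul_le_mul_right _ hQc).trans hle

/-! ### The numerical inequality. -/

/-- The cost inequality with denominators cleared. -/
def costCheck (n w t q₀ q₁ : ℕ) : Bool :=
  decide (w * (t + 4 * w) * (q₀ + q₁) * (n * t) + 16 * w * (n - 4) * n * (q₀ * q₁) ≤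
    2 * (2 * t - 3) * t * (q₀ * q₁))

/-- The finite range below the analytic bound, with `w` at its largest admissible value. -/
lemma small_cost_bound : ∀ n < 40, ∀ p < n, 4 ≤ n ∧ 1 ≤ p ∧ p + 2 ≤ n →
    p * (n - p) + 2 * p * (if p = 1 then n - 4 else n - p - 2) < n * (n - 1) ∧
    costCheck n (if p = 1 then n - 4 else n - p - 2) (n * (n - 1))
      (n * (n - 1) - 2 * p * (if p = 1 then n - 4 else n - p - 2))
      (n * (n - 1) - (p * (n - p) + 2 * p * (if p = 1 then n - 4 else n - p - 2))) := by
  decide +kernel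

/-- Here x = w / n, and 39 and 40 come from n ≥ 40. The constant lies just below 4 - 4/n - 6/n² at n
= 40, which is the right-hand side of the cost bound divided by n. -/
lemma unit_interval_bound {x : ℝ} (h0 : 0 ≤ x) (h1 : x ≤ 1) :
    x * (1 + 4 / 39 * x) *
      (1 / (1 - 2 * (x * (1 - x))) + 1 / (1 - 3 * (x * (1 - x)) - 2 / 39 * (1 - x) ^ 2)) +
      16 / 40 * x ≤ 3896 / 1000 := by
  have hA : 0 < 1 - 2 * (x * (1 - x)) := by nlinarith [sq_nonneg (x - 1 / 2)]
  have hB : 0 < 1 - 3 * (x * (1 - x)) - 2 / 39 * (1 - x) ^ 2 := by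
    nlinarith [sq_nonneg (x - 1 / 2)]
  rw [div_add_div _ _ hA.ne' hB.ne', mul_div_assoc', ← le_sub_iff_add_le,
    div_le_iff₀ (by positivity)]
  nlinarith [mul_nonneg h0 (sq_nonneg (x - 3 / 5)), mul_nonneg h0 (sq_nonneg (x ^ 2 - 3 / 5 * x)),
    mul_nonneg (sub_nonneg.2 h1) (sq_nonneg (x - 3 / 5)),
    mul_nonneg (sub_nonneg.2 h1) (sq_nonneg (x ^ 2 - 3 / 5 * x)), sq_nonneg (x - 3 / 5),
    mul_nonneg h0 (sub_nonneg.2 h1), sq_nonneg (x ^ 2 - 3 / 5)]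

lemma cost_mono {t p n w w' : ℝ} (hp : 0 ≤ p) (hn : 4 ≤ n) (hw : 0 ≤ w) (hww : w ≤ w')
    (ht : 0 < t) (hpn : p ≤ n) (hpos : p * (n - p) + 2 * p * w' < t) :
    w * (t + 4 * w) * (1 / (t - 2 * p * w) + 1 / (t - 2 * p * w - p * (n - p))) +
      16 * w * (n - 4) / t ≤
    w' * (t + 4 * w') * (1 / (t - 2 * p * w') + 1 / (t - 2 * p * w' - p * (n - p))) +
      16 * w' * (n - 4) / t := by
  have h1 : 2 * p * w ≤ 2 * p * w' := by gcongr
  have h2 : 0 ≤ p * (n - p) := mul_nonneg hp (by linarith)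
  have hA : 0 < t - 2 * p * w' := by linarith
  have hB : 0 < t - 2 * p * w' - p * (n - p) := by linarith
  have hA' : 0 < t - 2 * p * w := by linarith
  have hB' : 0 < t - 2 * p * w - p * (n - p) := by linarith
  have : 0 ≤ n - 4 := by linarith
  have hw' : 0 ≤ w' := hw.trans hww
  gcongr

lemma cost_bound_of_le {n p w : ℝ} (hn : 40 ≤ n) (hp : 1 ≤ p) (hw : 0 ≤ w) (hpw : p + w + 2 = n) :
    p * (n - p) + 2 * p * w < n * (n - 1) ∧
    w * (n * (n - 1) + 4 * w) * (1 / (n * (n - 1) - 2 * p * w) +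
      1 / (n * (n - 1) - 2 * p * w - p * (n - p))) + 16 * w * (n - 4) / (n * (n - 1)) ≤
    2 * (2 * (n * (n - 1)) - 3) / n := by
  obtain ⟨x, hx⟩ : ∃ x, w = n * x := ⟨w / n, by field_simp⟩
  have hn0 : 0 < n := by linarith
  have hx0 : 0 ≤ x := by
    by_contra h
    push Not at h
    nlinarith
  have hx1 : x ≤ 1 := by
    by_contra h
    push Not at h
    nlinarith
  obtain rfl : p = n - 2 - w := by linarith
  set t := n * (n - 1) with ht
  have ht0 : 0 < t := mul_pos hn0 (by linarith)
  have hpw' : (n - 2 - w) * w ≤ t * (x * (1 - x)) := by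
    have : t * (x * (1 - x)) - (n - 2 - w) * w = n * x * (1 + x) := by
      rw [ht, hx]; ring
    have : 0 ≤ n * x * (1 + x) := by positivity
    linarith
  have hy : x * (1 - x) ≤ 1 / 4 := by nlinarith [sq_nonneg (x - 1 / 2)]
  have hpw3 : 3 * ((n - 2 - w) * w) + 2 * (n - 2 - w) ≤
      t * (3 * (x * (1 - x)) + 2 / 39 * (1 - x) ^ 2) := by
    have h1 : 3 * (t * (x * (1 - x))) + 2 * n * (1 - x) ^ 2 -
        (3 * ((n - 2 - w) * w) + 2 * (n - 2 - w)) = n * (x + 5 * x ^ 2) + 4 := by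
      rw [ht, hx]; ring
    have h2 : 0 ≤ n * (x + 5 * x ^ 2) := by positivity
    have h3 : 39 * n ≤ t := by nlinarith
    have h4 := mul_le_mul_of_nonneg_right h3 (sq_nonneg (1 - x))
    linarith
  have h4w : t + 4 * w ≤ t * (1 + 4 / 39 * x) := by
    have : 39 * n * x ≤ t * x := by gcongr; nlinarith
    rw [hx]; linarith
  have hA : t * (1 - 2 * (x * (1 - x))) ≤ t - 2 * (n - 2 - w) * w := by linarith
  have hB : t * (1 - 3 * (x * (1 - x)) - 2 / 39 * (1 - x) ^ 2) ≤
      t - 2 * (n - 2 - w) * w - (n - 2 - w) * (n - (n - 2 - w)) := by linarith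
  have hA1 : 0 < 1 - 2 * (x * (1 - x)) := by linarith
  have hB1 : 0 < 1 - 3 * (x * (1 - x)) - 2 / 39 * (1 - x) ^ 2 := by
    nlinarith [sq_nonneg (x - 1 / 2)]
  have hA0 := mul_pos ht0 hA1
  have hB0 := mul_pos ht0 hB1
  refine ⟨by linarith only [hB, hB0], ?_⟩
  calc _ ≤ w * (t * (1 + 4 / 39 * x)) * (1 / (t * (1 - 2 * (x * (1 - x)))) +
        1 / (t * (1 - 3 * (x * (1 - x)) - 2 / 39 * (1 - x) ^ 2))) + 16 * w * (n - 1) / t := by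
        have : 0 ≤ n - 1 := by linarith only [hn]
        have hA2 := hA0.trans_le hA
        have hB2 := hB0.trans_le hB
        gcongr
        linarith only
    _ = n * (x * (1 + 4 / 39 * x) * (1 / (1 - 2 * (x * (1 - x))) +
          1 / (1 - 3 * (x * (1 - x)) - 2 / 39 * (1 - x) ^ 2))) + 16 * x := by
        have : n - 1 ≠ 0 := by linarith only [hn]
        rw [hx, ht]
        field_simp
    _ ≤ n * (3896 / 1000) := by
        have := mul_le_mul_of_nonneg_left (unit_interval_bound hx0 hx1) hn0.le
        have h2 := mul_le_mul_of_nonneg_right hn hx0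
        linarith only [this, h2]
    _ ≤ _ := by
        rw [le_div_iff₀ hn0, ht]
        have h2 := mul_le_mul_of_nonneg_right hn hn0.le
        linarith only [h2, hn]

lemma cost_le_of_clear {n t w a b : ℝ} (ht : 0 < t) (hn : 0 < n) (ha : 0 < a) (hb : 0 < b)
    (h : w * (t + 4 * w) * (a + b) * (n * t) + 16 * w * (n - 4) * n * (a * b) ≤
      2 * (2 * t - 3) * t * (a * b)) :
    w * (t + 4 * w) * (1 / a + 1 / b) + 16 * w * (n - 4) / t ≤ 2 * (2 * t - 3) / n := by
  rw [le_div_iff₀ hn]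
  have : (w * (t + 4 * w) * (1 / a + 1 / b) + 16 * w * (n - 4) / t) * n =
      (w * (t + 4 * w) * (a + b) * (n * t) + 16 * w * (n - 4) * n * (a * b)) / (t * (a * b)) := by
    field_simp
    ring
  rw [this, div_le_iff₀ (by positivity)]
  linarith

/-- The most uneven split, with all other classes before or all after. The cost increases with `w`
(`cost_mono`), so the largest `w` suffices. -/
lemma cost_bound_extreme {n p w : ℕ} (hp : 1 ≤ p) (hpw : p + w + 2 ≤ n) (h1 : p = 1 → w + 4 ≤ n) :
    (p * (n - p) + 2 * p * w : ℝ) < n * (n - 1) ∧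
    (w * (n * (n - 1) + 4 * w) * (1 / (n * (n - 1) - 2 * p * w) +
      1 / (n * (n - 1) - 2 * p * w - p * (n - p))) + 16 * w * (n - 4) / (n * (n - 1)) : ℝ) ≤
    2 * (2 * (n * (n - 1)) - 3) / n := by
  have hn4 : 4 ≤ n := by omega
  have hn4' : (4 : ℝ) ≤ n := by exact_mod_cast hn4
  have hp' : (1 : ℝ) ≤ p := by exact_mod_cast hp
  have hpn : (p : ℝ) ≤ n := by exact_mod_cast (by omega : p ≤ n)
  have ht0 : (0 : ℝ) < n * (n - 1) := mul_pos (by linarith) (by linarith)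
  obtain ⟨w', hww, hpos, hbd⟩ : ∃ w' : ℕ, w ≤ w' ∧
      (p * (n - p) + 2 * p * w' : ℝ) < n * (n - 1) ∧
      (w' * (n * (n - 1) + 4 * w') * (1 / (n * (n - 1) - 2 * p * w') +
        1 / (n * (n - 1) - 2 * p * w' - p * (n - p))) + 16 * w' * (n - 4) / (n * (n - 1)) : ℝ) ≤
      2 * (2 * (n * (n - 1)) - 3) / n := by
    rcases lt_or_ge n 40 with hn | hn
    · obtain ⟨h2, h3⟩ := small_cost_bound n hn p (by omega) ⟨hn4, hp, by omega⟩
      simp only [costCheck, decide_eq_true_eq] at h3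
      set w' := if p = 1 then n - 4 else n - p - 2 with hw'
      refine ⟨w', by split_ifs at hw' <;> omega, ?_⟩
      obtain ⟨q₁, hq₁⟩ := Nat.exists_eq_add_of_lt h2
      have hq0 : n * (n - 1) - 2 * p * w' = p * (n - p) + q₁ + 1 := by omega
      have hq1 : n * (n - 1) - (p * (n - p) + 2 * p * w') = q₁ + 1 := by omega
      rw [hq0, hq1] at h3
      have hn1 : 1 ≤ n * (n - 1) := by omega
      have htt : 3 ≤ 2 * (n * (n - 1)) := by
        have : 4 * 3 ≤ n * (n - 1) := Nat.mul_le_mul hn4 (by omega)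
        omega
      have h4 : (n * (n - 1) : ℝ) = p * (n - p) + 2 * p * w' + q₁ + 1 := by
        have := congrArg (Nat.cast (R := ℝ)) hq₁
        push_cast [Nat.cast_sub (by omega : 1 ≤ n), Nat.cast_sub (by omega : p ≤ n)] at this
        exact this
      have h5 := (Nat.cast_le (α := ℝ)).2 h3
      push_cast [Nat.cast_sub (by omega : 1 ≤ n), Nat.cast_sub (by omega : p ≤ n),
        Nat.cast_sub hn4, Nat.cast_sub htt] at h5
      have hB : (n * (n - 1) - 2 * p * w' - p * (n - p) : ℝ) = q₁ + 1 := by rw [h4]; ring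
      have hA : (n * (n - 1) - 2 * p * w' : ℝ) = p * (n - p) + q₁ + 1 := by rw [h4]; ring
      have hB0 : (0 : ℝ) < q₁ + 1 := by positivity
      have hA0 : (0 : ℝ) < p * (n - p) + q₁ + 1 := by
        have : (0 : ℝ) ≤ p * (n - p) := mul_nonneg (zero_le_one.trans hp') (sub_nonneg.2 hpn)
        linarith only [this, hB0]
      refine ⟨by linarith only [h4, hB0], ?_⟩
      rw [hB, hA]
      exact cost_le_of_clear ht0 (by linarith only [hn4']) hA0 hB0 h5
    · refine ⟨n - p - 2, by omega, ?_⟩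
      have h2 : ((n - p - 2 : ℕ) : ℝ) = n - p - 2 := by
        rw [Nat.cast_sub (by omega), Nat.cast_sub (by omega)]; norm_num
      refine cost_bound_of_le (by exact_mod_cast hn) hp' (Nat.cast_nonneg _) ?_
      rw [h2]; ring
  have hww' : (w : ℝ) ≤ w' := by exact_mod_cast hww
  refine ⟨?_, (cost_mono (by linarith) hn4' (Nat.cast_nonneg _) hww' ht0 hpn hpos).trans hbd⟩
  have : 2 * (p : ℝ) * w ≤ 2 * p * w' := by gcongr
  linarith

/-- Convexity of the reciprocal: with the sum of the denominators fixed, the uneven split is worst.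
-/
lemma one_div_add_one_div_le {a b x : ℝ} (hx : 0 ≤ x) (hxb : x ≤ b) (hab : b < a) :
    1 / (a - x) + 1 / (a - (b - x)) ≤ 1 / a + 1 / (a - b) := by
  have h1 : 0 < a - x := by linarith
  have h2 : 0 < a - (b - x) := by linarith
  have h3 : 0 < a := by linarith
  have h4 : 0 < a - b := by linarith
  rw [div_add_div _ _ h1.ne' h2.ne', div_add_div _ _ h3.ne' h4.ne',
    div_le_div_iff₀ (by positivity) (by positivity)]
  have : 0 ≤ x * (b - x) := mul_nonneg hx (by linarith)
  nlinarith

/-- The cost of a vertex in a class of size `p` with `s` vertices in earlier classes, added to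
its cost for the reversed order of the classes. -/
lemma cost_bound {n p w s : ℕ} (hp : 1 ≤ p) (hpw : p + w + 2 ≤ n) (h1 : p = 1 → w + 4 ≤ n)
    (hs : s + p ≤ n) :
    (2 * p * w + p * s : ℝ) < n * (n - 1) ∧
    (w * (n * (n - 1) + 4 * w) / (n * (n - 1) - 2 * p * w - p * s) +
      w * (n * (n - 1) + 4 * w) / (n * (n - 1) - 2 * p * w - p * (n - p - s)) +
      16 * w * (n - 4) / (n * (n - 1)) : ℝ) ≤ 2 * (2 * (n * (n - 1)) - 3) / n := by
  obtain ⟨h2, h3⟩ := cost_bound_extreme hp hpw h1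
  have hs' : (s : ℝ) ≤ n - p := by
    have : ((s + p : ℕ) : ℝ) ≤ n := by exact_mod_cast hs
    push_cast at this
    linarith
  have hps : (p * s : ℝ) ≤ p * (n - p) := by gcongr
  have hn1 : (1 : ℝ) ≤ n := by exact_mod_cast (by omega : 1 ≤ n)
  refine ⟨by linarith, le_trans ?_ h3⟩
  have h4 := one_div_add_one_div_le (a := n * (n - 1) - 2 * p * w) (b := p * (n - p))
    (x := (p * s : ℝ)) (by positivity) hps (by linarith)
  have h5 : (0 : ℝ) ≤ w * (n * (n - 1) + 4 * w) := by
    have : (0 : ℝ) ≤ n * (n - 1) := mul_nonneg (by linarith) (by linarith)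
    positivity
  have h6 := mul_le_mul_of_nonneg_left h4 h5
  have h7 : (p * (n - p) - p * s : ℝ) = p * (n - p - s) := by ring
  rw [h7] at h6
  rw [div_eq_mul_one_div, div_eq_mul_one_div _ (_ - (p : ℝ) * (n - p - s)), ← mul_add]
  linarith

/-! ### The case without large gain. -/

lemma lt_cost_of_not_exists {k : ℕ} {U : Finset α} (hUR : Disjoint U R)
    (hM : IsMatched H (U ∪ R) L) (hK : ∀ p ∈ U ∪ R, #(L p) = #R + k) (hcard : #U < #R)
    (col : α → Fin k)
    (hcol : ∀ u ∈ U, ∀ v ∈ U, u ≠ v → col u = col v → ∀ x ∈ L u, ∀ y ∈ L v, ¬ H.Adj x y)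
    (E : α → Finset α) (m : α → ℕ) (w : Fin k → ℕ)
    (hEm : ∀ u ∈ U, #(E u) + m u ≤ w (col u))
    (hmax : ∀ u ∈ U, ¬ HasGain H L (R \ E u) (L u) (m u + 1))
    (hgain : ∀ u ∈ U, ∀ a ∈ R \ E u, HasGain H L ((R \ E u).erase a) (L u) (m u))
    {a₀ : α} (ha₀ : a₀ ∈ R) (ha₀E : ∀ u ∈ U, a₀ ∉ E u)
    (hpos : ∀ u ∈ U, 2 * #{v ∈ U | col v = col u} * w (col u) +
      #{v ∈ U | col v = col u} * #{v ∈ U | col v < col u} < #R)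
    (hno : ¬ ∃ f, IsTransversal H L (U ∪ R) f) :
    (2 * #R - 3 : ℝ) < ∑ u ∈ U, (w (col u) * (#R + 4 * w (col u)) /
      (#R - 2 * #{v ∈ U | col v = col u} * w (col u) -
        #{v ∈ U | col v = col u} * #{v ∈ U | col v < col u}) : ℝ) +
      (∑ u ∈ U, #{b ∈ R \ E u | IsJoint H L (R \ E u) (L u) (m u) a₀ b} : ℕ) := by
  set q : Fin k → ℕ := fun i => #R - (2 * #{v ∈ U | col v = i} * w i +
      #{v ∈ U | col v = i} * #{v ∈ U | col v < i}) with hqd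
  have hlt : ∀ i, 2 * #{v ∈ U | col v = i} * w i +
      #{v ∈ U | col v = i} * #{v ∈ U | col v < i} < #R := by
    intro i
    rcases ({v ∈ U | col v = i} : Finset α).eq_empty_or_nonempty with h | ⟨u, hu⟩
    · rw [h]
      simp only [card_empty, mul_zero, zero_mul, add_zero]
      omega
    · obtain ⟨hu', rfl⟩ := mem_filter.1 hu
      exact hpos u hu'
  have hq0 : ∀ i, 0 < q i := fun i => Nat.sub_pos_of_lt (hlt i)
  obtain ⟨g, hg, hX⟩ := exists_cost hUR hM hK hcard col hcol E m hmax hgain ha₀ ha₀E q hq0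
    (fun i => by
      have h1 : ∑ u ∈ U with col u = i, 2 * m u ≤ #{v ∈ U | col v = i} * (2 * w i) := by
        rw [← smul_eq_mul]
        refine sum_le_card_nsmul _ _ _ fun u hu => ?_
        obtain ⟨hu', rfl⟩ := mem_filter.1 hu
        have := hEm u hu'
        omega
      have h2 : #{v ∈ U | col v = i} * (2 * w i) = 2 * #{v ∈ U | col v = i} * w i := by ring
      have := hlt i
      simp only [hqd]
      omega)
  have hX' : 2 * #R < ∑ u ∈ U, (#(E u) +
      #{b ∈ R \ E u | IsJoint H L (R \ E u) (L u) (m u) a₀ b} + g u) + 3 := by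
    by_contra h
    exact hno (hX (by omega))
  have hclass : ∀ i, q i * ∑ u ∈ U with col u = i, (#(E u) + g u) ≤
      ∑ u ∈ U with col u = i, w i * (#R + 4 * w i) := by
    intro i
    rw [sum_add_distrib, mul_add]
    refine (Nat.add_le_add_left (hg i) _).trans ?_
    rw [mul_sum, ← sum_add_distrib]
    refine sum_le_sum fun u hu => ?_
    obtain ⟨hu', rfl⟩ := mem_filter.1 hu
    have h1 := hEm u hu'
    -- A row of `E u` costs 1 ≤ (#R + 4w) / q, no more than one unit of `m u`, so both are absorbed
    -- into `w`.
    have h2 : q (col u) ≤ #R + 4 * w (col u) := by simp only [hqd]; omega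
    have h3 : #R + 4 * m u ≤ #R + 4 * w (col u) := by omega
    calc _ ≤ (#R + 4 * w (col u)) * #(E u) + m u * (#R + 4 * w (col u)) := by gcongr
      _ = (#(E u) + m u) * (#R + 4 * w (col u)) := by ring
      _ ≤ _ := Nat.mul_le_mul_right _ h1
  have hqc : ∀ i, (q i : ℝ) = #R - 2 * #{v ∈ U | col v = i} * w i -
      #{v ∈ U | col v = i} * #{v ∈ U | col v < i} := by
    intro i
    simp only [hqd]
    rw [Nat.cast_sub (hlt i).le]
    push_cast
    ring
  have hsum : ((∑ u ∈ U, (#(E u) + g u) : ℕ) : ℝ) ≤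
      ∑ u ∈ U, (w (col u) * (#R + 4 * w (col u)) / q (col u) : ℝ) := by
    rw [← sum_fiberwise U col, ← sum_fiberwise U col]
    push_cast
    refine sum_le_sum fun i _ => ?_
    have h1 := (Nat.cast_le (α := ℝ)).2 (hclass i)
    have h2 : (0 : ℝ) < q i := Nat.cast_pos.2 (hq0 i)
    push_cast at h1
    calc _ ≤ (∑ u ∈ U with col u = i, (w i * (#R + 4 * w i) : ℝ)) / q i := by
          rw [le_div_iff₀' h2]
          exact h1
      _ = _ := by
          rw [sum_div]
          refine sum_congr rfl fun u hu => ?_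
          rw [(mem_filter.1 hu).2]
  simp only [hqc] at hsum
  have h4 : ∑ u ∈ U, (#(E u) + #{b ∈ R \ E u | IsJoint H L (R \ E u) (L u) (m u) a₀ b} + g u) =
      ∑ u ∈ U, (#(E u) + g u) +
        ∑ u ∈ U, #{b ∈ R \ E u | IsJoint H L (R \ E u) (L u) (m u) a₀ b} := by
    rw [← sum_add_distrib]
    exact sum_congr rfl fun u _ => by ring
  rw [h4] at hX'
  have h5 := (Nat.cast_lt (α := ℝ)).2 hX'
  push_cast at h5 hsum ⊢
  linarith only [h5, hsum]

/-- (G - e) / (r - e) ≤ G / r when G ≤ r, so the rows lost to the sets `E u` do no harm. -/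
lemma le_mul_div_of_mul_le {J G e r c : ℝ} (h : (r - e) * J ≤ c * (G - e)) (hc : 0 ≤ c)
    (he : 0 ≤ e) (her : e < r) (hGr : G ≤ r) : J ≤ c * G / r := by
  have hr : 0 < r := he.trans_lt her
  rw [le_div_iff₀ hr]
  refine le_of_mul_le_mul_left ?_ (sub_pos.2 her)
  have h1 := mul_nonneg hc (mul_nonneg he (sub_nonneg.2 hGr))
  have h2 := mul_le_mul_of_nonneg_right h hr.le
  linarith only [h1, h2]

lemma two_le_of_add_card_le {k : ℕ} {U : Finset α} (hk : 1 ≤ k) (col : α → Fin k) (u : α)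
    (hd : k + #{v ∈ U | col v = col u} ≤ #U) : 2 ≤ k := by
  by_contra h
  obtain rfl : k = 1 := by omega
  rw [filter_true_of_mem fun v _ => Subsingleton.elim _ _] at hd
  omega

lemma exists_transversal_of_not_hasGain {k : ℕ} {U : Finset α} (hUR : Disjoint U R)
    (hM : IsMatched H (U ∪ R) L) (hK : ∀ p ∈ U ∪ R, #(L p) = #R + k) (hU : U.Nonempty)
    (hR : #R = #U * (#U - 1)) (hk : 2 ≤ k) (col : α → Fin k)
    (hcol : ∀ u ∈ U, ∀ v ∈ U, u ≠ v → col u = col v → ∀ x ∈ L u, ∀ y ∈ L v, ¬ H.Adj x y)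
    (hd : ∀ u ∈ U, k + #{v ∈ U | col v = col u} ≤ #U)
    (hng : ∀ u ∈ U, ¬ HasGain H L R (L u) (#U - #{v ∈ U | col v = col u} - k + 1)) :
    ∃ f, IsTransversal H L (U ∪ R) f := by
  by_contra hno
  obtain ⟨u₀, hu₀⟩ := hU
  obtain ⟨n, hn⟩ : ∃ n, n = #U := ⟨_, rfl⟩
  rw [← hn] at hR hd hng
  set w : Fin k → ℕ := fun i => n - #{v ∈ U | col v = i} - k with hw
  have hp1 : ∀ u ∈ U, 1 ≤ #{v ∈ U | col v = col u} := fun u hu =>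
    card_pos.2 ⟨u, by simp [hu]⟩
  -- For k = 2, a singleton class would leave a class of n - 1 vertices, against `hd`. Hence w ≤ n -
  -- 4 in every case.
  have hp2 : ∀ u ∈ U, k = 2 → 2 ≤ #{v ∈ U | col v = col u} := by
    rintro u hu rfl
    by_contra hlt
    have h1 : #{v ∈ U | col v = col u} = 1 := by have := hp1 u hu; omega
    have h2 := card_filter_add_card_filter_not (s := U) (fun v => col v = col u)
    have h3 := hd u hu
    obtain ⟨v, hv⟩ : ({v ∈ U | ¬ col v = col u} : Finset α).Nonempty := by
      rw [← card_pos]; omega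
    obtain ⟨hv, hvu⟩ := mem_filter.1 hv
    have h4 : ({v ∈ U | ¬ col v = col u} : Finset α) ⊆ ({x ∈ U | col x = col v} : Finset α) := by
      intro x hx
      obtain ⟨hx, hxu⟩ := mem_filter.1 hx
      exact mem_filter.2 ⟨hx, by omega⟩
    have := card_le_card h4
    have := hd v hv
    omega
  have hw4 : ∀ u ∈ U, #{v ∈ U | col v = col u} + w (col u) + 2 ≤ n ∧ w (col u) + 4 ≤ n := by
    intro u hu
    have h1 := hp1 u hu
    have h2 := hp2 u hu
    have h3 := hd u hu
    simp only [hw]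
    omega
  have hn4 : 4 ≤ n := by have := (hw4 u₀ hu₀).2; omega
  have hnR : n < #R := by
    rw [hR]
    calc n < n * 2 := by omega
      _ ≤ _ := Nat.mul_le_mul_left _ (by omega)
  have hRc : (#R : ℝ) = n * (n - 1) := by
    rw [hR]; push_cast [Nat.cast_sub (by omega : 1 ≤ n)]; rfl
  have : Nonempty W := by
    obtain ⟨x, -⟩ : (L u₀).Nonempty := by
      rw [← card_pos, hK u₀ (mem_union_left _ hu₀)]; omega
    exact ⟨x⟩
  choose! E hE m hEm hmax hgain using fun u hu => exists_nonessential _ _ (hng u hu)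
  have hEm : ∀ u ∈ U, #(E u) + m u ≤ w (col u) := hEm
  set G := ∑ u ∈ U, w (col u) with hG
  have hGR : G ≤ n * (n - 4) := by
    rw [hG, hn, ← smul_eq_mul]
    exact sum_le_card_nsmul _ _ _ fun u hu => by have := (hw4 u hu).2; omega
  have hGR' : G < #R := by
    rw [hR]
    exact hGR.trans_lt (Nat.mul_lt_mul_of_pos_left (by omega) (by omega))
  have hEG : ∑ u ∈ U, #(E u) + ∑ u ∈ U, m u ≤ G := by
    rw [← sum_add_distrib]
    exact sum_le_sum hEm
  obtain ⟨a₀, ha₀, ha₀E, hJ⟩ := exists_row hUR hM E m hgain (by omega)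
  set J := ∑ u ∈ U, #{b ∈ R \ E u | IsJoint H L (R \ E u) (L u) (m u) a₀ b} with hJd
  have hn4' : (4 : ℝ) ≤ n := by exact_mod_cast hn4
  have hR0 : (0 : ℝ) < #R := by exact_mod_cast (by omega : 0 < #R)
  have hJG : (J : ℝ) ≤ 8 * (n - 4) * G / #R := by
    have h1 : ∑ u ∈ U, 8 * m u ^ 2 ≤ 8 * (n - 4) * (G - ∑ u ∈ U, #(E u)) := by
      calc _ ≤ ∑ u ∈ U, 8 * (n - 4) * m u := by
            refine sum_le_sum fun u hu => ?_
            have h2 := hEm u hu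
            have h3 := (hw4 u hu).2
            rw [sq, ← mul_assoc]
            gcongr
            omega
        _ = 8 * (n - 4) * ∑ u ∈ U, m u := by rw [mul_sum]
        _ ≤ _ := by gcongr; omega
    have h2 := (Nat.cast_le (α := ℝ)).2 (hJ.trans h1)
    push_cast [Nat.cast_sub hn4, Nat.cast_sub (by omega : ∑ u ∈ U, #(E u) ≤ G),
      Nat.cast_sub (by omega : ∑ u ∈ U, #(E u) ≤ #R)] at h2
    have h3 : (∑ u ∈ U, (#(E u) : ℝ)) < #R := by exact_mod_cast (by omega : ∑ u ∈ U, #(E u) < #R)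
    exact le_mul_div_of_mul_le h2 (mul_nonneg (by norm_num) (sub_nonneg.2 hn4'))
      (sum_nonneg fun _ _ => Nat.cast_nonneg _) h3
      (by exact_mod_cast hGR'.le)
  have hs : ∀ u ∈ U, #{v ∈ U | col v < col u} + #{v ∈ U | col v = col u} +
      #{v ∈ U | (col v).rev < (col u).rev} = n := by
    intro u hu
    have h1 := card_filter_add_card_filter_not (s := U) (fun v => col v < col u)
    have h2 := card_filter_add_card_filter_not (s := ({v ∈ U | ¬ col v < col u} : Finset α))
      (fun v => col v = col u)
    rw [filter_filter, filter_filter] at h2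
    have h3 : ({v ∈ U | ¬ col v < col u ∧ col v = col u} : Finset α) =
        ({v ∈ U | col v = col u} : Finset α) :=
      filter_congr fun v _ => ⟨fun h => h.2, fun h => ⟨h.not_lt, h⟩⟩
    have h4 : ({v ∈ U | ¬ col v < col u ∧ ¬ col v = col u} : Finset α) =
        ({v ∈ U | (col v).rev < (col u).rev} : Finset α) :=
      filter_congr fun v _ => by rw [Fin.rev_lt_rev]; omega
    rw [h3, h4] at h2
    omega
  have hrev : ∀ u v, ((col v).rev = (col u).rev) = (col v = col u) := fun u v => by
    rw [Fin.rev_inj]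
  have hcb := fun u hu => cost_bound (s := #{v ∈ U | col v < col u}) (hp1 u hu) (hw4 u hu).1
    (fun _ => (hw4 u hu).2) (by have := hs u hu; omega)
  have hcb' := fun u hu => cost_bound (s := #{v ∈ U | (col v).rev < (col u).rev}) (hp1 u hu)
    (hw4 u hu).1 (fun _ => (hw4 u hu).2) (by have := hs u hu; omega)
  have h1 := lt_cost_of_not_exists hUR hM hK (hn ▸ hnR) col hcol E m w hEm hmax hgain ha₀ ha₀E
    (fun u hu => by
      have := (hcb u hu).1
      rw [← hRc] at this
      exact_mod_cast this) hno
  -- Reversing the colours turns the number s of earlier vertices into n - p - s; the two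
  -- inequalities add up to a contradiction with `cost_bound`.
  have h2 := lt_cost_of_not_exists hUR hM hK (hn ▸ hnR) (fun u => (col u).rev)
    (fun u hu v hv huv h => hcol u hu v hv huv (by rwa [Fin.rev_inj] at h)) E m
    (fun i => w i.rev) (fun u hu => by simpa using hEm u hu) hmax hgain ha₀ ha₀E
    (fun u hu => by
      have := (hcb' u hu).1
      rw [← hRc] at this
      simp only [hrev, Fin.rev_rev]
      exact_mod_cast this) hno
  simp only [hrev, Fin.rev_rev] at h2
  have h3 := sum_le_sum fun u hu => (hcb u hu).2
  rw [← hRc] at h3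
  rw [sum_add_distrib, sum_add_distrib, sum_const, ← hn, nsmul_eq_mul,
    mul_div_cancel₀ _ (by linarith only [hn4'] : (n : ℝ) ≠ 0)] at h3
  have h4 : ∑ u ∈ U, (16 * w (col u) * (n - 4) / #R : ℝ) = 2 * (8 * (n - 4) * G / #R) := by
    rw [hG]
    push_cast
    rw [mul_sum, sum_div, mul_sum]
    exact sum_congr rfl fun u _ => by ring
  have h5 : ∀ u ∈ U, (#{v ∈ U | (col v).rev < (col u).rev} : ℝ) =
      n - #{v ∈ U | col v = col u} - #{v ∈ U | col v < col u} := by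
    intro u hu
    have := congrArg (Nat.cast (R := ℝ)) (hs u hu)
    push_cast at this
    linarith only [this]
  rw [sum_congr rfl fun u hu => by rw [h5 u hu]] at h2
  linarith only [h1, h2, h3, h4, hJG]

/-! ### The induction. -/

lemma exists_transversal {k : ℕ} (hk : 1 ≤ k) (col : α → Fin k) (U R : Finset α)
    (L : α → Finset W) (hUR : Disjoint U R) (hM : IsMatched H (U ∪ R) L)
    (hL : ∀ p ∈ U ∪ R, #R + k ≤ #(L p))
    (hcol : ∀ u ∈ U, ∀ v ∈ U, u ≠ v → col u = col v → ∀ x ∈ L u, ∀ y ∈ L v, ¬ H.Adj x y)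
    (hR : #U ≤ 2 ∨ #U * (#U - 1) ≤ #R) (hW : Nonempty W) :
    ∃ f, IsTransversal H L (U ∪ R) f := by
  induction hN : #U + #R using Nat.strong_induction_on generalizing U R L with
  | _ N ih =>
  -- it suffices to treat lists of size exactly `#R + k`
  obtain ⟨L₀, hL₀, hK⟩ : ∃ L₀ : α → Finset W, (∀ p, L₀ p ⊆ L p) ∧
      ∀ p ∈ U ∪ R, #(L₀ p) = #R + k := by
    choose! L₀ h1 h2 using fun p hp => exists_subset_card_eq (hL p hp)
    refine ⟨fun p => if p ∈ U ∪ R then L₀ p else ∅, fun p => ?_, fun p hp => ?_⟩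
    · dsimp only
      split_ifs with h
      · exact h1 p h
      · exact empty_subset _
    · simp only [hp, if_true]
      exact h2 p hp
  suffices h : ∃ f, IsTransversal H L₀ (U ∪ R) f by
    obtain ⟨f, hf⟩ := h
    exact ⟨f, hf.mono Subset.rfl fun p _ => hL₀ p⟩
  replace hM := hM.mono Subset.rfl fun p _ => hL₀ p
  replace hcol : ∀ u ∈ U, ∀ v ∈ U, u ≠ v → col u = col v → ∀ x ∈ L₀ u, ∀ y ∈ L₀ v,
    ¬ H.Adj x y := fun u hu v hv huv h x hx y hy =>
      hcol u hu v hv huv h x (hL₀ u hx) y (hL₀ v hy)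
  clear hL
  have hdisj : ∀ u ∈ U, u ∉ R := fun u hu h => disjoint_left.1 hUR hu h
  have hUP : U ⊆ U ∪ R := subset_union_left
  have hRP : R ⊆ U ∪ R := subset_union_right
  -- choosing a transversal of some rows `A` first, then one for `R \ A` and `U' ⊆ U`
  have step : ∀ A ⊆ R, ∀ f, IsTransversal H L₀ A f → ∀ U' ⊆ U, #U' + #(R \ A) < N →
      (#U' ≤ 2 ∨ #U' * (#U' - 1) ≤ #(R \ A)) →
      ∃ g, IsTransversal H L₀ (U' ∪ R) g ∧ ∀ a ∈ A, g a = f a := by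
    intro A hA f hf U' hU' hlt hR'
    have hAU : ∀ p ∈ U' ∪ R \ A, p ∉ A := by
      intro p hp hpA
      rcases mem_union.1 hp with h | h
      · exact hdisj p (hU' h) (hA hpA)
      · exact (mem_sdiff.1 h).2 hpA
    have hsub : U' ∪ R \ A ⊆ U ∪ R := union_subset_union hU' sdiff_subset
    -- Lists lose at most #A elements while #R drops by exactly #A, so the list condition persists.
    obtain ⟨g, hg⟩ := ih _ hlt U' (R \ A) (fun p => free H A f (L₀ p))
      (hUR.mono hU' sdiff_subset) (hM.mono hsub fun p _ => free_subset)
      (fun p hp => by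
        have h1 := card_le_card_free_add hM (hA.trans hRP) hf.1 (hsub hp) (hAU p hp)
        rw [hK p (hsub hp)] at h1
        rw [card_sdiff_of_subset hA]
        have := card_le_card hA
        omega)
      (fun u hu v hv huv h x hx y hy => hcol u (hU' hu) v (hU' hv) huv h x (free_subset hx) y
        (free_subset hy)) hR' rfl
    obtain ⟨h, hh, hhf, -⟩ := hf.glue hg (disjoint_left.2 fun p hp hp' => hAU p hp' hp)
    have : A ∪ (U' ∪ R \ A) = U' ∪ R := by
      rw [union_left_comm, union_sdiff_of_subset hA]
    rw [this] at hh
    exact ⟨h, hh, hhf⟩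
  rcases U.eq_empty_or_nonempty with rfl | hU
  · rcases R.eq_empty_or_nonempty with rfl | ⟨a, ha⟩
    · exact ⟨fun _ => hW.some, by simp [IsTransversal]⟩
    · obtain ⟨x, hx⟩ : (L₀ a).Nonempty := by rw [← card_pos, hK a (by simp [ha])]; omega
      obtain ⟨g, hg, -⟩ := step {a} (by simpa) _ (isTransversal_singleton hx) ∅ (by simp) (by
        rw [card_sdiff_of_subset (by simpa)]
        have := card_pos.2 ⟨a, ha⟩
        simp
        omega) (by simp)
      exact ⟨g, hg⟩
  -- a vertex for which a large gain is possible can be coloured last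
  by_cases hdel : ∃ u ∈ U, HasGain H L₀ R (L₀ u) (#U - #{v ∈ U | col v = col u} + 1 - k)
  · obtain ⟨u, hu, hgain⟩ := hdel
    have hp1 : 1 ≤ #{v ∈ U | col v = col u} := card_pos.2 ⟨u, by simp [hu]⟩
    have hpn : #{v ∈ U | col v = col u} ≤ #U := card_filter_le _ _
    obtain ⟨A, hA, f, hf, hg, hAg⟩ := hgain.exists_small hM hRP (hUP hu) (hdisj u hu)
    have hAR := card_le_card hA
    have hU1 := card_pos.2 hU
    obtain ⟨g, hg1, hg2⟩ := step A hA f hf (U.erase u) (erase_subset _ _) (by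
      rw [card_erase_of_mem hu, card_sdiff_of_subset hA]; omega) (by
      rw [card_erase_of_mem hu, card_sdiff_of_subset hA]
      rcases hR with h | h
      · left; omega
      · right
        obtain ⟨n, hn⟩ : ∃ n, #U = n + 1 := ⟨#U - 1, by omega⟩
        -- The required gain is at most #U - 1 because k and p are at least 1.
        have h1 : #A ≤ 2 * n := by omega
        have h2 : (n + 1) * n = n * (n - 1) + 2 * n := by
          rcases n with _ | n
          · rfl
          · simp only [Nat.add_sub_cancel]; ring
        rw [hn] at h ⊢
        simp only [Nat.add_sub_cancel] at h ⊢
        omega)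
    have hne : ∀ p ∈ U.erase u ∪ R, p ≠ u := by
      rintro p hp rfl
      rcases mem_union.1 hp with h | h
      · simp at h
      · exact hdisj _ hu h
    -- an element of the list of `u` without coloured neighbours
    obtain ⟨x, hx⟩ : (free H (U.erase u ∪ R) g (L₀ u)).Nonempty := by
      -- `A` blocks at most #A minus the gain, the other rows at most #R - #A, the other classes at
      -- most #U - p, and the class of `u` nothing: fewer than #R + k in total.
      have hsub : blocked H (U.erase u ∪ R) g (L₀ u) ⊆ blocked H A f (L₀ u) ∪
          blocked H (R \ A ∪ ({v ∈ U | col v ≠ col u} : Finset α)) g (L₀ u) := by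
        intro y hy
        obtain ⟨hy, p, hp, hpy⟩ := mem_blocked.1 hy
        by_cases hpA : p ∈ A
        · exact mem_union_left _ (mem_blocked.2 ⟨hy, p, hpA, hg2 p hpA ▸ hpy⟩)
        refine mem_union_right _ (mem_blocked.2 ⟨hy, p, ?_, hpy⟩)
        rcases mem_union.1 hp with h | h
        · refine mem_union_right _ (mem_filter.2 ⟨mem_of_mem_erase h, fun hc => ?_⟩)
          exact hcol p (mem_of_mem_erase h) u hu (hne p hp) hc _ (hg1.1 p hp) y hy hpy
        · exact mem_union_left _ (mem_sdiff.2 ⟨h, hpA⟩)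
      have hBP : R \ A ∪ ({v ∈ U | col v ≠ col u} : Finset α) ⊆ U.erase u ∪ R := by
        refine union_subset (sdiff_subset.trans subset_union_right) fun v hv => ?_
        obtain ⟨hv, hvu⟩ := mem_filter.1 hv
        exact mem_union_left _ (mem_erase.2 ⟨fun h => hvu (by rw [h]), hv⟩)
      have h1 := card_blocked_le (f := g) hM
        (hBP.trans (union_subset_union (erase_subset _ _) Subset.rfl))
        (fun p hp => hg1.1 p (hBP hp)) (hUP hu) fun h => hne u (hBP h) rfl
      have h2 := (card_le_card hsub).trans (card_union_le _ _)
      have h3 := card_union_le (R \ A) ({v ∈ U | col v ≠ col u} : Finset α)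
      have h4 := card_blocked_add_card_free (H := H) (A := U.erase u ∪ R) (f := g) (T := L₀ u)
      have h5 := card_filter_add_card_filter_not (s := U) (fun v => col v = col u)
      have h6 : #({v ∈ U | col v ≠ col u} : Finset α) =
        #({v ∈ U | ¬ col v = col u} : Finset α) := rfl
      rw [hK u (hUP hu)] at h4
      rw [card_sdiff_of_subset hA] at h3
      rw [← card_pos]
      omega
    have := hg1.insert_update (fun h => hne u h rfl) hx
    rw [← insert_union, insert_erase hu] at this
    exact ⟨_, this⟩
  push Not at hdel
  have hd : ∀ u ∈ U, k + #{v ∈ U | col v = col u} ≤ #U := by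
    intro u hu
    by_contra h
    refine hdel u hu ?_
    have : #U - #{v ∈ U | col v = col u} + 1 - k = 0 := by
      have := card_pos.2 hU
      have : 1 ≤ #{v ∈ U | col v = col u} := card_pos.2 ⟨u, by simp [hu]⟩
      omega
    rw [this]
    exact hasGain_zero
  obtain ⟨u₀, hu₀⟩ := id hU
  have hk2 : 2 ≤ k := two_le_of_add_card_le hk col u₀ (hd u₀ hu₀)
  have hU3 : 3 ≤ #U := by
    have := hd u₀ hu₀
    have : 1 ≤ #{v ∈ U | col v = col u₀} := card_pos.2 ⟨u₀, by simp [hu₀]⟩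
    omega
  replace hR := hR.resolve_left (by omega)
  -- While #R exceeds n(n - 1), a surplus row may take any label.
  rcases hR.lt_or_eq with hlt | heq
  · obtain ⟨a, ha⟩ : R.Nonempty := by rw [← card_pos]; omega
    obtain ⟨x, hx⟩ : (L₀ a).Nonempty := by rw [← card_pos, hK a (hRP ha)]; omega
    obtain ⟨g, hg, -⟩ := step {a} (by simpa) _ (isTransversal_singleton hx) U Subset.rfl (by
      rw [card_sdiff_of_subset (by simpa), card_singleton]
      omega) (by
      right
      rw [card_sdiff_of_subset (by simpa), card_singleton]
      omega)
    exact ⟨g, hg⟩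
  · refine exists_transversal_of_not_hasGain hUR hM hK hU heq.symm hk2 col hcol hd ?_
    intro u hu
    have := hdel u hu
    have := hd u hu
    have h1 : #U - #{v ∈ U | col v = col u} - k + 1 = #U - #{v ∈ U | col v = col u} + 1 - k := by
      omega
    rwa [h1]

/-! ### From transversals to chromatic numbers. -/

lemma colorable_of_dpColorable {V : Type u} [Fintype V] {G : SimpleGraph V} {m : ℕ}
    (h : DPColorable G m) : G.Colorable m := by
  -- The cover whose matchings join equal colours: its independent sets of full size are the proper
  -- m-colourings.
  let C : Cover G (V × Fin m) :=
    { H :=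
        { Adj := fun x y => (x.1 = y.1 ∧ x.2 ≠ y.2) ∨ (G.Adj x.1 y.1 ∧ x.2 = y.2)
          symm := ⟨fun x y h => h.imp (fun h => ⟨h.1.symm, h.2.symm⟩)
            fun h => ⟨h.1.symm, h.2.symm⟩⟩
          loopless := ⟨fun x h => h.elim (fun h => h.2 rfl) fun h => G.irrefl h.1⟩ }
      L := fun a => {x | x.1 = a}
      disjoint := fun a b hab => Set.disjoint_left.2 fun x hx hy => hab (hx.symm.trans hy)
      cover := by ext x; simp
      clique := by
        rintro a ⟨x, i⟩ rfl ⟨y, j⟩ rfl hxy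
        exact Or.inl ⟨rfl, fun h => hxy (Prod.ext rfl h)⟩
      no_edge := by
        rintro a b hab hG ⟨x, i⟩ rfl ⟨y, j⟩ rfl (h | h)
        · exact hab h.1
        · exact hG h.1
      matching := by
        rintro a b hG ⟨x, i⟩ rfl ⟨y, j⟩ rfl ⟨z, l⟩ hz h1 h2
        obtain rfl : z = y := hz
        have hne := hG.ne
        refine Prod.ext rfl ?_
        rcases h1 with h1 | h1
        · exact absurd h1.1 hne
        rcases h2 with h2 | h2
        · exact absurd h2.1 hne
        exact h1.2.symm.trans h2.2 }
  have hfold : C.IsFold m := by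
    intro a
    have : C.L a = (fun i : Fin m => (a, i)) '' Set.univ := by
      ext ⟨x, i⟩
      simp [C, eq_comm]
    rw [this, Function.Injective.encard_image (Prod.mk_right_injective a), Set.encard_univ]
    simp
  obtain ⟨I, hI, hcard⟩ := h _ C hfold
  have hinj : Set.InjOn Prod.fst I := by
    intro x hx y hy hxy
    by_contra hne
    exact hI hx hy hne (Or.inl ⟨hxy, fun h => hne (Prod.ext hxy h)⟩)
  have hsurj : Prod.fst '' I = Set.univ := by
    refine (Set.toFinite _).eq_of_subset_of_encard_le (Set.subset_univ _) ?_
    rw [hinj.encard_image, hcard, Set.encard_univ]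
  choose c hcI hc using fun a => (Set.eq_univ_iff_forall.1 hsurj a)
  refine ⟨SimpleGraph.Coloring.mk (fun a => (c a).2) fun {a b} hab heq => ?_⟩
  refine hI (hcI a) (hcI b) (fun h => hab.ne ?_) (Or.inr ⟨?_, heq⟩)
  · rw [← hc a, h, hc b]
  · rwa [hc a, hc b]

lemma dpColorable_join {V : Type} [Fintype V] {G : SimpleGraph V} {s k : ℕ} (hk : 1 ≤ k)
    (D : G.Coloring (Fin k))
    (hs : Fintype.card V ≤ 2 ∨ Fintype.card V * (Fintype.card V - 1) ≤ s) :
    DPColorable (join G (⊤ : SimpleGraph (Fin s))) (s + k) := by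
  intro W C hC
  have hfin : ∀ p, (C.L p).Finite := fun p => Set.finite_of_encard_eq_coe (hC p)
  have hcard : ∀ p, #(hfin p).toFinset = s + k := fun p => by
    have := hC p
    rw [(hfin p).encard_eq_coe_toFinset_card] at this
    exact_mod_cast this
  set U : Finset (V ⊕ Fin s) := univ.map ⟨Sum.inl, Sum.inl_injective⟩ with hU
  set R : Finset (V ⊕ Fin s) := univ.map ⟨Sum.inr, Sum.inr_injective⟩ with hR
  have hUR : ∀ p, p ∈ U ∨ p ∈ R := by
    rintro (p | p) <;> simp [hU, hR]
  have hRc : #R = s := by simp [hR]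
  have hUc : #U = Fintype.card V := by simp [hU]
  by_cases hW : Nonempty W
  -- Colours of rows are never used, so they get the dummy value 0.
  · obtain ⟨f, hf', hind'⟩ := exists_transversal (H := C.H) hk (Sum.elim D fun _ => ⟨0, hk⟩) U R
      (fun p => (hfin p).toFinset) (by
        rw [disjoint_left]
        rintro p hp hp'
        simp only [hU, hR, mem_map, mem_univ, true_and, Function.Embedding.coeFn_mk] at hp hp'
        obtain ⟨a, rfl⟩ := hp
        obtain ⟨b, hb⟩ := hp'
        cases hb) (by
        intro p _ q _ hpq x hx y hy z hz h1 h2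
        simp only [Set.Finite.mem_toFinset] at hx hy hz
        by_cases h : (join G (⊤ : SimpleGraph (Fin s))).Adj p q
        · exact C.matching p q h x hx y hy z hz h1 h2
        · exact absurd h1 (C.no_edge p q hpq h x hx y hy)) (by
        intro p _
        rw [hcard, hRc]) (by
        intro u hu v hv huv hcol x hx y hy
        simp only [hU, mem_map, mem_univ, true_and, Function.Embedding.coeFn_mk] at hu hv
        obtain ⟨u, rfl⟩ := hu
        obtain ⟨v, rfl⟩ := hv
        simp only [Set.Finite.mem_toFinset] at hx hy
        refine C.no_edge _ _ huv (fun h => ?_) x hx y hy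
        have : G.Adj u v := by simpa [join] using h
        exact D.valid this hcol) (by rwa [hUc, hRc]) hW
    have hf : ∀ p, f p ∈ C.L p := fun p =>
      (hfin p).mem_toFinset.1 (hf' p ((@mem_union _ (_) _ _ _).2 (hUR p)))
    have hind := fun p q => hind' p ((@mem_union _ (_) _ _ _).2 (hUR p)) q ((@mem_union _ (_) _ _ _).2 (hUR q))
    have hinj : Function.Injective f := by
      intro p q hpq
      by_contra hne
      exact Set.disjoint_left.1 (C.disjoint hne) (hf p) (hpq ▸ hf q)
    refine ⟨Set.range f, ?_, ?_⟩
    · rintro _ ⟨p, rfl⟩ _ ⟨q, rfl⟩ hpq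
      exact hind p q fun h => hpq (by rw [h])
    · rw [← Set.image_univ, hinj.encard_image, Set.encard_univ]
  · have : IsEmpty (V ⊕ Fin s) := ⟨fun p => by
      obtain ⟨x, -⟩ : (hfin p).toFinset.Nonempty := by rw [← card_pos, hcard]; omega
      exact hW ⟨x⟩⟩
    exact ⟨∅, by simp, by simp⟩

/-- K_s uses s distinct colours, none of which appears on G. -/
lemma add_le_of_colorable_join {V : Type*} {G : SimpleGraph V} {s k m : ℕ}
    (hk : ∀ j, G.Colorable j → k ≤ j)
    (h : (join G (⊤ : SimpleGraph (Fin s))).Colorable m) : s + k ≤ m := by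
  obtain ⟨D⟩ := h
  have hadj : ∀ v i, (join G (⊤ : SimpleGraph (Fin s))).Adj (Sum.inl v) (Sum.inr i) :=
    fun v i => by simp [join]
  have hinj : Function.Injective fun i : Fin s => D (Sum.inr i) := by
    intro i j hij
    by_contra hne
    exact D.valid (by simpa [join] using hne) hij
  set T := univ.image fun i : Fin s => D (Sum.inr i) with hT
  have hTc : #T = s := by rw [hT, card_image_of_injective _ hinj]; simp
  have hcol : G.Colorable (Fintype.card {c // c ∉ T}) := by
    refine SimpleGraph.Coloring.colorable (SimpleGraph.Coloring.mk
      (fun v => ⟨D (Sum.inl v), fun h => ?_⟩) fun {v w} hvw heq => ?_)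
    · obtain ⟨i, -, hi⟩ := mem_image.1 h
      exact D.valid (hadj v i) hi.symm
    · exact D.valid (v := Sum.inl v) (w := Sum.inl w) (by simpa [join] using hvw)
        (congrArg Subtype.val heq)
  have h1 := hk _ hcol
  have h2 : Fintype.card {c // c ∉ T} = m - s := by
    rw [Fintype.card_subtype_compl]
    simp [hTc]
  have h3 := card_le_univ T
  rw [hTc, Fintype.card_fin] at h3
  omega

lemma zDPGraph_le {V : Type} [Fintype V] [Nonempty V] (G : SimpleGraph V) {s : ℕ}
    (hs : Fintype.card V ≤ 2 ∨ Fintype.card V * (Fintype.card V - 1) ≤ s) : zDPGraph G ≤ s := by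
  refine iInf₂_le s ?_
  obtain ⟨k, hk, hmin⟩ : ∃ k, G.Colorable k ∧ ∀ j, G.Colorable j → k ≤ j := by
    have h : ∃ k, G.Colorable k := ⟨_, G.colorable_of_fintype⟩
    exact ⟨Nat.find h, Nat.find_spec h, fun j hj => Nat.find_min' h hj⟩
  obtain ⟨D⟩ := hk
  have hk1 : 1 ≤ k := by
    have := (D (Classical.arbitrary V)).2
    omega
  refine le_antisymm ?_ ?_
  · refine (iInf₂_le (s + k) ⟨by omega, dpColorable_join hk1 D hs⟩).trans ?_
    rw [SimpleGraph.le_chromaticNumber_iff_colorable]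
    exact fun m hm => add_le_of_colorable_join hmin hm
  · exact le_iInf₂ fun m hm => (colorable_of_dpColorable hm.2).chromaticNumber_le

end DPColoring

theorem theorem1p9 (n : ℕ) (hn : 2 ≤ n) :
    ∃ z : ℕ, DPColoring.zDP n = (z : ℕ∞) ∧
      (z : ℝ) ≤ (n : ℝ) ^ 2 - ((n : ℝ) + 3) / 2 := by
  have : Nonempty (Fin n) := ⟨⟨0, by omega⟩⟩
  obtain ⟨s, hs, hbound⟩ : ∃ s : ℕ, (n ≤ 2 ∨ n * (n - 1) ≤ s) ∧
      (s : ℝ) ≤ (n : ℝ) ^ 2 - ((n : ℝ) + 3) / 2 := by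
    -- For n = 2 the value n(n - 1) = 2 exceeds the bound 3/2, so s = 0 is needed; for n ≥ 3 it
    -- suffices, since n(n - 1) ≤ n² - (n + 3)/2 is equivalent to n ≥ 3.
    rcases hn.eq_or_lt with rfl | h
    · exact ⟨0, Or.inl le_rfl, by norm_num⟩
    · refine ⟨n * (n - 1), Or.inr le_rfl, ?_⟩
      have h3 : (3 : ℝ) ≤ n := by exact_mod_cast h
      push_cast [Nat.cast_sub (by omega : 1 ≤ n)]
      linarith
  have hle : DPColoring.zDP n ≤ s :=
    iSup_le fun G => DPColoring.zDPGraph_le G (by rwa [Fintype.card_fin])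
  obtain ⟨z, hz⟩ := ENat.ne_top_iff_exists.1 (hle.trans_lt (ENat.natCast_lt_top s)).ne
  refine ⟨z, hz.symm, le_trans ?_ hbound⟩
  rw [← hz] at hle
  exact_mod_cast hle
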